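/- Let $m\ge 3$ be an odd integer and $d\in\{0,1,2,3\}$. On the Schwartz space $\mathcal S(\mathbb R^m)$ of complex-valued functions let $\Delta$ be the Laplace operator, $\mathbb E=\sum_i x_i\partial_{x_i}$ the Euler operator, $$h=-\tfrac{\Delta}{2}+\tfrac{|x|^2}{2},\quad e=-\tfrac{\Delta}{4}-\tfrac{|x|^2}{4}+\tfrac{\mathbb E}{2}+\tfrac m4,\quad f=\tfrac{\Delta}{4}+\tfrac{|x|^2}{4}+\tfrac{\mathbb E}{2}+\tfrac m4,$$ and $\Omega=1+h^2+2ef+2fe$. For $n\ge 0$ let $D_n(x)=\frac1{(2n)!}\prod_{\ell=0}^{n-1}\bigl(x^2-(\ell+\tfrac12)^2\bigr)$, and let $D_n(\sqrt\Omega)$ denote the operator obtained by substituting $\Omega$ for $x^2$. Put $$\mathcal D_{0110}=D_1+2D_2,\qquad \mathcal D_{0011}=\sum_{n\ge1}\Bigl(D_{2^n}+\sum_{j=1}^{n-1}2D_{2^n+2^j}\Bigr),\qquad \mathcal D_{0010}=2D_3+\sum_{n\ge0}\Bigl(D_{2^n+1}+\sum_{j=1}^{n-1}2D_{2^n+1+2^j}\Bigr),$$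 $$F(\sqrt\Omega)=(m-2)\Bigl(\mathcal D_{0110}(\sqrt\Omega)+\mathcal D_{0011}(\sqrt\Omega)+2\mathcal D_{0010}(\sqrt\Omega)\Bigr)+\Bigl(\frac{m+1}{2}\Bigr)^2 .$$ The Hermite functions are the functions $2^jj!\,L_j^{m/2+k-1}(|x|^2)\,H(x)\,e^{-|x|^2/2}$ with $j,k\ge 0$, $L_j^\alpha$ the generalized Laguerre polynomial, and $H$ a harmonic homogeneous polynomial of degree $k$ with complex coefficients. Then there is exactly one continuous linear operator $T_d$ on $\mathcal S(\mathbb R^m)$ that satisfies $$T_d=e^{i\frac{\pi}{2}dF(\sqrt\Omega)}\,e^{i\frac{\pi}{2}(h-\frac m2)}$$ on all Hermite functions, where $F(\sqrt\Omega)$ and both exponentials are given by their series, convergent in $\mathcal S(\mathbb R^m)$ when applied successively to a Hermite function. Moreover, for all $u\in\mathcal S(\mathbb R^m)$ and $y\in\mathbb R^m$, $$(T_du)(y)=\frac1{(2\pi)^{m/2}}\int_{\mathbb R^m}K_m(x,y)\,u(x)\,dx,\qquad K_m(x,y)=\cos\langle x,y\rangle+i^{d+1}\sin\langle x,y\rangle,$$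 the integral being absolutely convergent. -/

import Mathlib

open scoped SchwartzMap LineDeriv Laplacian Nat

/-- The Schwartz space `𝓢(ℝ^m)` of complex valued rapidly decreasing functions. -/
abbrev SchwartzSpace (m : ℕ) : Type := 𝓢(EuclideanSpace ℝ (Fin m), ℂ)

/-- The algebra of continuous linear operators on `𝓢(ℝ^m)`. -/
abbrev SchwartzOp (m : ℕ) : Type := SchwartzSpace m →L[ℂ] SchwartzSpace m

noncomputable section

/-! The differential operators on `𝓢(ℝ^m)`. -/

/-- The Laplace operator. -/
def lapOp (m : ℕ) : SchwartzOp m :=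
  LineDeriv.laplacianCLM ℂ (EuclideanSpace ℝ (Fin m)) (SchwartzSpace m)

/-- Multiplication by `|x|²`. -/
def normSqOp (m : ℕ) : SchwartzOp m :=
  SchwartzMap.smulLeftCLM ℂ (fun x : EuclideanSpace ℝ (Fin m) => ((‖x‖ ^ 2 : ℝ) : ℂ))

/-- Multiplication by the coordinate `x_i`. -/
def coordOp (m : ℕ) (i : Fin m) : SchwartzOp m :=
  SchwartzMap.smulLeftCLM ℂ (fun x : EuclideanSpace ℝ (Fin m) => ((x i : ℝ) : ℂ))

/-- The partial derivative `∂_{x_i}`. -/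
def partialOp (m : ℕ) (i : Fin m) : SchwartzOp m :=
  LineDeriv.lineDerivOpCLM ℂ (SchwartzSpace m) (EuclideanSpace.single i (1 : ℝ))

/-- The Euler operator `∑ x_i ∂_{x_i}`. -/
def eulerOp (m : ℕ) : SchwartzOp m := ∑ i, coordOp m i * partialOp m i

theorem lapOp_apply (m : ℕ) (f : SchwartzSpace m) (x : EuclideanSpace ℝ (Fin m)) :
    lapOp m f x = Laplacian.laplacian (f : EuclideanSpace ℝ (Fin m) → ℂ) x := by
  rw [lapOp, SchwartzMap.laplacianCLM_eq, SchwartzMap.laplacian_apply]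

theorem normSqOp_apply (m : ℕ) (f : SchwartzSpace m) (x : EuclideanSpace ℝ (Fin m)) :
    normSqOp m f x = ((‖x‖ ^ 2 : ℝ) : ℂ) * f x := by
  rw [normSqOp, SchwartzMap.smulLeftCLM_apply_apply (by fun_prop), smul_eq_mul]

theorem coordOp_apply (m : ℕ) (i : Fin m) (f : SchwartzSpace m)
    (x : EuclideanSpace ℝ (Fin m)) : coordOp m i f x = ((x i : ℝ) : ℂ) * f x := by
  have h : (fun x : EuclideanSpace ℝ (Fin m) => ((x i : ℝ) : ℂ)).HasTemperateGrowth :=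
    (Complex.ofRealCLM ∘L (EuclideanSpace.proj i : EuclideanSpace ℝ (Fin m) →L[ℝ] ℝ)
      ).hasTemperateGrowth
  rw [coordOp, SchwartzMap.smulLeftCLM_apply_apply h, smul_eq_mul]

theorem partialOp_apply (m : ℕ) (i : Fin m) (f : SchwartzSpace m)
    (x : EuclideanSpace ℝ (Fin m)) :
    partialOp m i f x = lineDeriv ℝ f x (EuclideanSpace.single i (1 : ℝ)) := by
  rw [partialOp, LineDeriv.lineDerivOpCLM_apply, SchwartzMap.lineDerivOp_apply]

/-! The `sl(2)` triple `h, e, f` and its Casimir element. -/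

/-- `h = -Δ/2 + |x|²/2`. -/
def hOp (m : ℕ) : SchwartzOp m := -((1 / 2 : ℂ) • lapOp m) + (1 / 2 : ℂ) • normSqOp m

/-- `e = -Δ/4 - |x|²/4 + 𝔼/2 + m/4`. -/
def eOp (m : ℕ) : SchwartzOp m :=
  -((1 / 4 : ℂ) • lapOp m) - (1 / 4 : ℂ) • normSqOp m + (1 / 2 : ℂ) • eulerOp m
    + ((m : ℂ) / 4) • 1

/-- `f = Δ/4 + |x|²/4 + 𝔼/2 + m/4`. -/
def fOp (m : ℕ) : SchwartzOp m :=
  (1 / 4 : ℂ) • lapOp m + (1 / 4 : ℂ) • normSqOp m + (1 / 2 : ℂ) • eulerOp m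
    + ((m : ℂ) / 4) • 1

/-- The Casimir operator `Ω = 1 + h² + 2ef + 2fe`. -/
def casimirOp (m : ℕ) : SchwartzOp m :=
  1 + hOp m ^ 2 + (2 : ℂ) • (eOp m * fOp m) + (2 : ℂ) • (fOp m * eOp m)

/-- The even polynomial `D_n(x) = (1/(2n)!) ∏_{l<n} (x² - (l + 1/2)²)`, written as a polynomial
in the variable `x²`. -/
def dPoly (n : ℕ) : Polynomial ℂ :=
  Polynomial.C (1 / ((2 * n)! : ℂ)) *
    ∏ l ∈ Finset.range n, (Polynomial.X - Polynomial.C (((l : ℂ) + 1 / 2) ^ 2))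

/-- `D_n(√Ω)`: the operator `Ω` substituted for `x²` in `D_n(x)`. -/
def dOp (m n : ℕ) : SchwartzOp m := Polynomial.aeval (casimirOp m) (dPoly n)

/-! Operators given by infinite series are only partially defined on `𝓢(ℝ^m)`; they are
represented by their graphs, relations `A : 𝓢 → 𝓢 → Prop` where `A f g` says that `f` lies in the
domain and is sent to `g`. All series are taken in the topology of `𝓢(ℝ^m)`. -/

/-- `𝒟₀₁₁₀(√Ω) = D₁(√Ω) + 2 D₂(√Ω)`. -/
def calD0110 (m : ℕ) : SchwartzOp m := dOp m 1 + (2 : ℂ) • dOp m 2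

/-- `𝒟₀₀₁₁(√Ω) = ∑_{n ≥ 1} (D_{2^n}(√Ω) + ∑_{j=1}^{n-1} 2 D_{2^n+2^j}(√Ω))`
(the summation index `n` is shifted by one). -/
def CalD0011 (m : ℕ) (f g : SchwartzSpace m) : Prop :=
  HasSum (fun n : ℕ => (dOp m (2 ^ (n + 1)) +
    ∑ j ∈ Finset.Ico 1 (n + 1), (2 : ℂ) • dOp m (2 ^ (n + 1) + 2 ^ j)) f) g

/-- `𝒟₀₀₁₀(√Ω) = 2 D₃(√Ω) + ∑_{n ≥ 0} (D_{2^n+1}(√Ω) + ∑_{j=1}^{n-1} 2 D_{2^n+1+2^j}(√Ω))`. -/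
def CalD0010 (m : ℕ) (f g : SchwartzSpace m) : Prop :=
  ∃ s : SchwartzSpace m,
    HasSum (fun n : ℕ => (dOp m (2 ^ n + 1) +
      ∑ j ∈ Finset.Ico 1 n, (2 : ℂ) • dOp m (2 ^ n + 1 + 2 ^ j)) f) s ∧
    g = (2 : ℂ) • dOp m 3 f + s

/-- `F(√Ω) = (m-2)(𝒟₀₁₁₀(√Ω) + 𝒟₀₀₁₁(√Ω) + 2 𝒟₀₀₁₀(√Ω)) + ((m+1)/2)²`. -/
def CasimirF (m : ℕ) (f g : SchwartzSpace m) : Prop :=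
  ∃ p q : SchwartzSpace m, CalD0011 m f p ∧ CalD0010 m f q ∧
    g = ((m : ℂ) - 2) • (calD0110 m f + p + (2 : ℂ) • q) + (((m : ℂ) + 1) / 2) ^ 2 • f

/-- The operator exponential `exp(c A) = ∑_n (c^n / n!) A^n` of a partially defined operator:
`f` is in its domain if all `A^n f` are defined and the series converges. -/
def OpExp {m : ℕ} (c : ℂ) (A : SchwartzSpace m → SchwartzSpace m → Prop)
    (f g : SchwartzSpace m) : Prop :=
  ∃ u : ℕ → SchwartzSpace m, u 0 = f ∧ (∀ n, A (u n) (u (n + 1))) ∧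
    HasSum (fun n : ℕ => (c ^ n / (n ! : ℂ)) • u n) g

/-- The composition `exp(i (π/2) d F(√Ω)) exp(i (π/2) (h - m/2))`. -/
def ExpProduct (m d : ℕ) (f g : SchwartzSpace m) : Prop :=
  ∃ f₁ : SchwartzSpace m,
    OpExp (Complex.I * (Real.pi / 2)) (fun u v => v = (hOp m - ((m : ℂ) / 2) • 1) u) f f₁ ∧
    OpExp (Complex.I * (Real.pi / 2) * d) (CasimirF m) f₁ g

/-! The Hermite functions. -/

/-- The generalized Laguerre polynomial `L_j^α`. -/
def laguerreL (j : ℕ) (α t : ℝ) : ℝ :=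
  ∑ n ∈ Finset.range (j + 1),
    Real.Gamma (j + α + 1) / (n ! * (j - n)! * Real.Gamma (n + α + 1)) * (-t) ^ n

/-- `ℋ_k`: homogeneous polynomials of degree `k` that are null solutions of the Laplace
operator. -/
def IsSphericalHarmonic {m : ℕ} (k : ℕ) (H : MvPolynomial (Fin m) ℂ) : Prop :=
  H.IsHomogeneous k ∧ ∑ i, MvPolynomial.pderiv i (MvPolynomial.pderiv i H) = 0

/-- `v` is a Hermite function
`2^j j! L_j^{m/2+k-1}(|x|²) H(x) e^{-|x|²/2}`, with `j, k ≥ 0` and `H ∈ ℋ_k`. -/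
def IsHermiteFunction {m : ℕ} (v : SchwartzSpace m) : Prop :=
  ∃ (j k : ℕ) (H : MvPolynomial (Fin m) ℂ), IsSphericalHarmonic k H ∧
    ∀ x : EuclideanSpace ℝ (Fin m),
      v x = ((2 ^ j * j ! * laguerreL j ((m : ℝ) / 2 + k - 1) (‖x‖ ^ 2) : ℝ) : ℂ)
        * MvPolynomial.eval (fun i => ((x i : ℝ) : ℂ)) H * (Real.exp (-‖x‖ ^ 2 / 2) : ℂ)

/-- `T` is the operator `T_d = exp(i (π/2) d F(√Ω)) exp(i (π/2) (h - m/2))` on `𝓢(ℝ^m)`: the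
continuous linear operator that is given on every Hermite function by the (convergent) operator
exponentials. -/
def IsTd (m d : ℕ) (T : SchwartzOp m) : Prop :=
  ∀ v : SchwartzSpace m, IsHermiteFunction v → ExpProduct m d v (T v)

/-- The kernel `cos⟨x,y⟩ + i^{d+1} sin⟨x,y⟩`. -/
def hartleyKernel {m : ℕ} (d : ℕ) (x y : EuclideanSpace ℝ (Fin m)) : ℂ :=
  (Real.cos (inner ℝ x y) : ℂ) + Complex.I ^ (d + 1) * (Real.sin (inner ℝ x y) : ℂ)

end

/-! Every Hermite function is a joint eigenvector: `h` has eigenvalue m/2 + k + 2j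
(`hOp_gaussPoly_hermitePoly`) and Ω has eigenvalue (k + m/2 - 1)²
(`casimirOp_gaussPoly_hermitePoly`). As m is odd, √Ω becomes N + 1/2 with N = k + (m - 3)/2 a
natural number, and D_n(N + 1/2) is the binomial coefficient C(N + n, 2n). It vanishes for n > N, so
the infinite series in F are finite on each Hermite function.

The arithmetic core is that the combination of the D_n inside F is congruent to N² modulo 4
(`exists_sum_choose_eq_sq`). Hence F ≡ k² modulo 4 (`exists_F_eq_sq`), and the first exponential is
1 for even k and i^d for odd k, while the exponential of h - m/2 is i^(k + 2j).

The integral operator is ((1 + i^d)/2) 𝓕⁻¹ + ((1 - i^d)/2) 𝓕 in unitary normalisation. Hermite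
functions are eigenvectors of 𝓕 and 𝓕⁻¹ with eigenvalues (∓i)^(k + 2j), because both transforms fix
the Gaussian and commute with the creation operators up to ∓i. This yields the same eigenvalues
(`hartleyOp_hermite`), so the integral operator is a T_d (`isTd_hartleyOp`).

Uniqueness is the density of the span of the Hermite functions in the Schwartz topology
(`dense_range_gaussPoly`). The Schwartz seminorms are bounded by L² norms of h^n u
(`hermiteBounded_seminorm`), h^n maps the span onto itself, and the span is dense in L² by Fourier
injectivity (`eq_zero_of_inner_gaussPoly_eq_zero`). -/

/-! ### A congruence modulo 4 for sums of binomial coefficients. -/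

section BinomialCongruence

open Polynomial Finset

/-- The linear functional on `ℤ[X]` sending `X ^ a` to `N.choose a`. -/
noncomputable def chooseFunctional (N : ℕ) : ℤ[X] →ₗ[ℤ] ℤ :=
  ∑ a ∈ range (N + 1), (N.choose a : ℤ) • Polynomial.lcoeff ℤ a

theorem chooseFunctional_apply (N : ℕ) (p : ℤ[X]) :
    chooseFunctional N p = ∑ a ∈ range (N + 1), (N.choose a : ℤ) * p.coeff a := by
  simp [chooseFunctional, LinearMap.sum_apply]

theorem chooseFunctional_X_pow (N a : ℕ) : chooseFunctional N (X ^ a) = N.choose a := by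
  rw [chooseFunctional_apply]
  simp only [coeff_X_pow, mul_ite, mul_one, mul_zero, sum_ite_eq', mem_range]
  split_ifs with h
  · rfl
  · rw [Nat.choose_eq_zero_of_lt (by omega)]; simp

theorem chooseFunctional_X_pow_mul {N a : ℕ} (h : N < a) (p : ℤ[X]) :
    chooseFunctional N (X ^ a * p) = 0 := by
  rw [chooseFunctional_apply]
  refine sum_eq_zero fun b hb => ?_
  rw [coeff_X_pow_mul', if_neg (by have := mem_range.1 hb; omega), mul_zero]

theorem chooseFunctional_succ_X_mul (N : ℕ) (p : ℤ[X]) :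
    chooseFunctional (N + 1) (X * p) = chooseFunctional N ((1 + X) * p) := by
  induction p using Polynomial.induction_on' with
  | add p q hp hq => simp only [mul_add, map_add, hp, hq]
  | monomial a c =>
    have h1 : X * monomial a c = c • (X ^ (a + 1) : ℤ[X]) := by
      rw [← C_mul_X_pow_eq_monomial, smul_eq_C_mul]; ring
    have h2 : (1 + X) * monomial a c = c • (X ^ a : ℤ[X]) + c • (X ^ (a + 1) : ℤ[X]) := by
      rw [← C_mul_X_pow_eq_monomial, smul_eq_C_mul, smul_eq_C_mul]; ring
    rw [h1, h2, map_add, map_smul, map_smul, map_smul, chooseFunctional_X_pow,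
      chooseFunctional_X_pow, chooseFunctional_X_pow, Nat.choose_succ_succ]
    push_cast
    simp [mul_add]

/-- Pascal's rule, iterated n times: raising N by one trades a factor `X` for `1 + X`. -/
theorem chooseFunctional_add_X_pow_mul (n : ℕ) :
    ∀ (N : ℕ) (p : ℤ[X]),
      chooseFunctional (N + n) (X ^ n * p) = chooseFunctional N ((1 + X) ^ n * p) := by
  induction n with
  | zero => simp
  | succ n ih =>
    intro N p
    rw [← add_assoc, pow_succ', mul_assoc, chooseFunctional_succ_X_mul,
      show (1 + X) * (X ^ n * p) = X ^ n * ((1 + X) * p) by ring, ih]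
    ring_nf

/-- This turns identities in powers of t = X + X² into identities between the values of D_n: factor
t as X(1 + X) and absorb (1 + X)^n into the upper index. -/
theorem chooseFunctional_X_add_X_sq_pow (N n : ℕ) :
    chooseFunctional N ((X + X ^ 2) ^ n) = ((N + n).choose (2 * n) : ℤ) := by
  rw [show ((X : ℤ[X]) + X ^ 2) ^ n = (1 + X) ^ n * X ^ n by rw [← mul_pow]; ring,
    ← chooseFunctional_add_X_pow_mul, ← pow_add, chooseFunctional_X_pow, two_mul]

theorem exists_add_sq_pow_two_pow {R : Type*} [CommRing R] (x : R) (k : ℕ) :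
    ∃ p : R, (x + x ^ 2) ^ 2 ^ k = x ^ 2 ^ k + x ^ 2 ^ (k + 1) + 2 * p := by
  induction k with
  | zero => exact ⟨0, by ring⟩
  | succ k ih =>
    obtain ⟨p, hp⟩ := ih
    refine ⟨x ^ 2 ^ k * x ^ 2 ^ (k + 1) + 2 * p * x ^ 2 ^ k + 2 * p * x ^ 2 ^ (k + 1)
      + 2 * p ^ 2, ?_⟩
    rw [pow_succ 2 k, pow_mul, hp, pow_succ 2 (k + 1), pow_mul x (2 ^ (k + 1)) 2,
      pow_succ 2 k, pow_mul x (2 ^ k) 2]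
    ring

/-- Squaring is additive modulo 2, so the sum telescopes; the sign of the last term is irrelevant
there. -/
theorem exists_sum_add_sq_pow_two_pow {R : Type*} [CommRing R] (x : R) (i K : ℕ) :
    ∃ p : R, ∑ n ∈ range K, (x + x ^ 2) ^ 2 ^ (n + i) = x ^ 2 ^ i + x ^ 2 ^ (K + i) + 2 * p := by
  induction K with
  | zero => exact ⟨-x ^ 2 ^ i, by simp; ring⟩
  | succ K ih =>
    obtain ⟨p, hp⟩ := ih
    obtain ⟨q, hq⟩ := exists_add_sq_pow_two_pow x (K + i)
    refine ⟨p + x ^ 2 ^ (K + i) + q, ?_⟩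
    rw [sum_range_succ, hp, hq, show K + 1 + i = K + i + 1 by ring]
    ring

/-- The double sum consists of the cross terms of a square. The diagonal terms of that square are
the single powers with index shifted by one, which leaves the two boundary terms. -/
theorem sum_pow_two_pow_add_eq {R : Type*} [CommRing R] (t : R) (K : ℕ) :
    ∑ n ∈ range K, (t ^ 2 ^ (n + 1) + ∑ j ∈ Ico 1 (n + 1), 2 * t ^ (2 ^ (n + 1) + 2 ^ j))
      = (∑ n ∈ range K, t ^ 2 ^ (n + 1)) ^ 2 + t ^ 2 - t ^ 2 ^ (K + 1) := by
  induction K with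
  | zero => simp
  | succ K ih =>
    rw [sum_range_succ, ih, sum_range_succ]
    have h : ∑ j ∈ Ico 1 (K + 1), 2 * t ^ (2 ^ (K + 1) + 2 ^ j)
        = 2 * t ^ 2 ^ (K + 1) * ∑ n ∈ range K, t ^ 2 ^ (n + 1) := by
      rw [sum_Ico_eq_sum_range, mul_sum]
      refine sum_congr (by simp) fun j _ => ?_
      rw [pow_add, add_comm 1 j]; ring
    rw [h, pow_succ 2 (K + 1), pow_mul]
    ring

/-- Work modulo 4 and modulo `x ^ 2 ^ K`. The telescoped sums are only known modulo 2, which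
suffices because one is squared and the other is doubled. What remains is t + 2t² + (x⁴ + t²) + 2tx
= x + 6x² + 8x³ + 4x⁴ ≡ x + 2x². -/
theorem exists_sum_polynomial_eq {R : Type*} [CommRing R] (x : R) (K : ℕ) :
    ∃ p q : R, let t := x + x ^ 2
      (t ^ 1 + 2 * t ^ 2) +
      ∑ n ∈ range K, (t ^ 2 ^ (n + 1) + ∑ j ∈ Ico 1 (n + 1), 2 * t ^ (2 ^ (n + 1) + 2 ^ j)) +
      2 * (2 * t ^ 3 +
        ∑ n ∈ range K, (t ^ (2 ^ n + 1) + ∑ j ∈ Ico 1 n, 2 * t ^ (2 ^ n + 1 + 2 ^ j)))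
      = x + 2 * x ^ 2 + x ^ 2 ^ K * q + 4 * p := by
  obtain ⟨a, ha⟩ := exists_sum_add_sq_pow_two_pow x 1 K
  obtain ⟨b, hb⟩ := exists_sum_add_sq_pow_two_pow x 0 K
  have h3 : ∑ n ∈ range K, ((x + x ^ 2) ^ (2 ^ n + 1) +
      ∑ j ∈ Ico 1 n, 2 * (x + x ^ 2) ^ (2 ^ n + 1 + 2 ^ j))
      = (x + x ^ 2) * ∑ n ∈ range K, (x + x ^ 2) ^ 2 ^ (n + 0) +
        2 * ∑ n ∈ range K, ∑ j ∈ Ico 1 n, (x + x ^ 2) ^ (2 ^ n + 1 + 2 ^ j) := by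
    rw [sum_add_distrib, mul_sum, mul_sum]
    congr 1
    · refine sum_congr rfl fun n _ => ?_
      rw [pow_succ' (x + x ^ 2), add_zero]
    · exact sum_congr rfl fun n _ => (mul_sum _ _ _).symm
  have h4 : (x + x ^ 2) ^ 2 ^ (K + 1) = x ^ 2 ^ K * (x ^ 2 ^ K * ((1 + x) ^ 2) ^ 2 ^ K) := by
    rw [pow_succ' 2 K, pow_mul, ← mul_pow, ← mul_pow]
    ring
  simp only [sum_pow_two_pow_add_eq, ha, h3, hb, h4]
  generalize ∑ n ∈ range K, ∑ j ∈ Ico 1 n, (x + x ^ 2) ^ (2 ^ n + 1 + 2 ^ j) = c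
  rw [pow_succ 2 K, pow_mul x (2 ^ K) 2, add_zero]
  simp only [pow_zero, pow_one]
  generalize x ^ 2 ^ K = Y
  refine ⟨a ^ 2 + a * x ^ 2 + a * Y ^ 2 + (x + x ^ 2) * b + c + (x + x ^ 2) ^ 3
    + x ^ 2 + 2 * x ^ 3 + x ^ 4, 2 * x ^ 2 * Y + Y ^ 3 -
      Y * ((1 + x) ^ 2) ^ 2 ^ K + 2 * (x + x ^ 2), ?_⟩
  ring

/-- The congruence modulo `4` behind the values of `F`. -/
theorem exists_sum_choose_eq_sq {N K : ℕ} (h : N < 2 ^ K) :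
    ∃ z : ℤ, let D : ℕ → ℤ := fun n => ((N + n).choose (2 * n) : ℤ)
      (D 1 + 2 * D 2) +
      ∑ n ∈ range K, (D (2 ^ (n + 1)) + ∑ j ∈ Ico 1 (n + 1), 2 * D (2 ^ (n + 1) + 2 ^ j)) +
      2 * (2 * D 3 + ∑ n ∈ range K, (D (2 ^ n + 1) + ∑ j ∈ Ico 1 n, 2 * D (2 ^ n + 1 + 2 ^ j)))
      = N ^ 2 + 4 * z := by
  obtain ⟨p, q, hpq⟩ := exists_sum_polynomial_eq (X : ℤ[X]) K
  refine ⟨chooseFunctional N p, ?_⟩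
  have two (r : ℤ[X]) : chooseFunctional N (2 * r) = 2 * chooseFunctional N r := by
    rw [two_mul, two_mul, map_add]
  have four (r : ℤ[X]) : chooseFunctional N (4 * r) = 4 * chooseFunctional N r := by
    rw [show 4 * r = 2 * (2 * r) by ring, two, two]; ring
  have := congrArg (chooseFunctional N) hpq
  -- The multiple of `X ^ 2 ^ K` is killed because N < 2^K; the remaining X + 2X² goes to N + N(N -
  -- 1) = N².
  simp only [map_add, map_sum, two, four, chooseFunctional_X_add_X_sq_pow,
    chooseFunctional_X_pow_mul h] at this
  simp only
  rw [this, chooseFunctional_X_pow, show (X : ℤ[X]) = X ^ 1 by simp, chooseFunctional_X_pow]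
  have h2 : (N.choose 2 : ℤ) * 2 = N * (N - 1) := by
    have := Nat.cast_choose_two ℚ N
    qify
    rw [this]
    ring
  rw [Nat.choose_one_right]
  linarith

end BinomialCongruence

/-! ### The Gaussian, its polynomial multiples, and the canonical commutation relations. -/

noncomputable section Gaussian

/-- One term of the exponential series bounds (1 + r)^N by N! e^(1 + r), and 1 + r - r²/2 is at most
3/2, its value at r = 1. -/
theorem one_add_pow_mul_exp_neg_sq_le {r : ℝ} (hr : 0 ≤ r) (N : ℕ) :
    (1 + r) ^ N * Real.exp (-r ^ 2 / 2) ≤ N ! * Real.exp (3 / 2) := by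
  have h1 : (1 + r) ^ N / N ! ≤ Real.exp (1 + r) := Real.pow_div_factorial_le_exp _ (by positivity) N
  rw [div_le_iff₀ (by positivity)] at h1
  calc (1 + r) ^ N * Real.exp (-r ^ 2 / 2)
      ≤ Real.exp (1 + r) * N ! * Real.exp (-r ^ 2 / 2) := by gcongr
    _ = N ! * Real.exp (1 + r + -r ^ 2 / 2) := by rw [Real.exp_add (1 + r)]; ring
    _ ≤ N ! * Real.exp (3 / 2) := by
        gcongr
        nlinarith [sq_nonneg (r - 1)]

theorem exists_pow_mul_iteratedFDeriv_exp_neg_sq_le {E : Type*} [NormedAddCommGroup E]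
    [InnerProductSpace ℝ E] (k n : ℕ) :
    ∃ C : ℝ, ∀ x : E,
      ‖x‖ ^ k * ‖iteratedFDeriv ℝ n (fun x : E => Real.exp (-‖x‖ ^ 2 / 2)) x‖ ≤ C := by
  have htg : (fun x : E => -‖x‖ ^ 2 / 2).HasTemperateGrowth := by
    simp_rw [div_eq_mul_inv]
    fun_prop
  obtain ⟨l, C, hC0, hC⟩ := htg.norm_iteratedFDeriv_le_uniform n
  refine ⟨n ! * (max 1 C) ^ n * ((k + l * n)! * Real.exp (3 / 2)), fun x => ?_⟩
  have hb : ‖iteratedFDeriv ℝ n (Real.exp ∘ fun x : E => -‖x‖ ^ 2 / 2) x‖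
      ≤ n ! * Real.exp (-‖x‖ ^ 2 / 2) * (max 1 C * (1 + ‖x‖) ^ l) ^ n := by
    refine norm_iteratedFDeriv_comp_le (N := n) Real.contDiff_exp (htg.1.of_le (by exact_mod_cast le_top))
      le_rfl x (fun i _ => ?_) (fun i hi hin => ?_)
    · rw [norm_iteratedFDeriv_eq_norm_iteratedDeriv]
      simp [iteratedDeriv_eq_iterate]
    · refine (hC i hin x).trans ?_
      -- The Faà di Bruno estimate wants the i-th derivative of the exponent bounded by the i-th
      -- power of one constant, so that constant is made at least 1.
      have h1 : 1 ≤ max 1 C * (1 + ‖x‖) ^ l :=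
        one_le_mul_of_one_le_of_one_le (le_max_left _ _)
          (one_le_pow₀ (by linarith [norm_nonneg x]))
      calc C * (1 + ‖x‖) ^ l ≤ max 1 C * (1 + ‖x‖) ^ l := by gcongr; exact le_max_right _ _
        _ ≤ _ := le_self_pow₀ h1 (by omega)
  calc ‖x‖ ^ k * ‖iteratedFDeriv ℝ n (fun x : E => Real.exp (-‖x‖ ^ 2 / 2)) x‖
      ≤ (1 + ‖x‖) ^ k *
        (n ! * Real.exp (-‖x‖ ^ 2 / 2) * (max 1 C * (1 + ‖x‖) ^ l) ^ n) := by
        gcongr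
        · linarith
        · exact hb
    _ = n ! * (max 1 C) ^ n * ((1 + ‖x‖) ^ (k + l * n) * Real.exp (-‖x‖ ^ 2 / 2)) := by
        rw [mul_pow, pow_add, pow_mul]; ring
    _ ≤ _ := by
        exact mul_le_mul_of_nonneg_left (one_add_pow_mul_exp_neg_sq_le (norm_nonneg x) _)
          (by positivity)

/-- The Gaussian `e^{-|x|²/2}` as a real valued Schwartz function. -/
def realGaussian (m : ℕ) : 𝓢(EuclideanSpace ℝ (Fin m), ℝ) where
  toFun x := Real.exp (-‖x‖ ^ 2 / 2)
  smooth' := by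
    exact Real.contDiff_exp.comp (((contDiff_norm_sq ℝ).neg).div_const 2)
  decay' k n := exists_pow_mul_iteratedFDeriv_exp_neg_sq_le k n

/-- The Gaussian `e^{-|x|²/2}`. -/
def gaussian (m : ℕ) : SchwartzSpace m :=
  SchwartzMap.postcompCLM (𝕜 := ℝ) Complex.ofRealCLM (realGaussian m)

theorem gaussian_apply {m : ℕ} (x : EuclideanSpace ℝ (Fin m)) :
    gaussian m x = (Real.exp (-‖x‖ ^ 2 / 2) : ℂ) := by
  rw [gaussian, SchwartzMap.postcompCLM_apply]; rfl

open MvPolynomial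

theorem hasTemperateGrowth_coord {m : ℕ} (i : Fin m) :
    (fun x : EuclideanSpace ℝ (Fin m) => ((x i : ℝ) : ℂ)).HasTemperateGrowth :=
  (Complex.ofRealCLM ∘L (EuclideanSpace.proj i : EuclideanSpace ℝ (Fin m) →L[ℝ] ℝ)
    ).hasTemperateGrowth

theorem hasTemperateGrowth_eval {m : ℕ} (p : MvPolynomial (Fin m) ℂ) :
    (fun x : EuclideanSpace ℝ (Fin m) => eval (fun i => ((x i : ℝ) : ℂ)) p).HasTemperateGrowth := by
  induction p using MvPolynomial.induction_on with
  | C a => simp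
  | add p q hp hq => simp_rw [map_add]; exact hp.add hq
  | mul_X p i hp => simp_rw [map_mul, eval_X]; exact hp.mul (hasTemperateGrowth_coord i)

/-- The Schwartz function `p(x) e^{-|x|²/2}` for a polynomial `p`. -/
def gaussPoly (m : ℕ) : MvPolynomial (Fin m) ℂ →ₗ[ℂ] SchwartzSpace m where
  toFun p := SchwartzMap.smulLeftCLM ℂ
    (fun x : EuclideanSpace ℝ (Fin m) => eval (fun i => ((x i : ℝ) : ℂ)) p) (gaussian m)
  map_add' p q := by
    ext x
    rw [add_apply, SchwartzMap.smulLeftCLM_apply_apply (hasTemperateGrowth_eval (p + q)),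
      SchwartzMap.smulLeftCLM_apply_apply (hasTemperateGrowth_eval p),
      SchwartzMap.smulLeftCLM_apply_apply (hasTemperateGrowth_eval q), eval_add, add_smul]
  map_smul' c p := by
    ext x
    rw [smul_apply, SchwartzMap.smulLeftCLM_apply_apply (hasTemperateGrowth_eval (c • p)),
      SchwartzMap.smulLeftCLM_apply_apply (hasTemperateGrowth_eval p), smul_eval, smul_eq_mul,
      smul_eq_mul, smul_eq_mul, mul_assoc, RingHom.id_apply]

variable {m : ℕ}

theorem gaussPoly_apply (p : MvPolynomial (Fin m) ℂ) (x : EuclideanSpace ℝ (Fin m)) :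
    gaussPoly m p x = eval (fun i => ((x i : ℝ) : ℂ)) p * (Real.exp (-‖x‖ ^ 2 / 2) : ℂ) := by
  rw [← gaussian_apply]
  exact SchwartzMap.smulLeftCLM_apply_apply (hasTemperateGrowth_eval p) _ x

theorem gaussPoly_one : gaussPoly m 1 = gaussian m := by
  ext x; rw [gaussPoly_apply, gaussian_apply]; simp

theorem coordOp_gaussPoly (i : Fin m) (p : MvPolynomial (Fin m) ℂ) :
    coordOp m i (gaussPoly m p) = gaussPoly m (X i * p) := by
  ext x
  rw [coordOp_apply, gaussPoly_apply, gaussPoly_apply, eval_mul, eval_X, mul_assoc]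

theorem hasLineDerivAt_eval (i : Fin m) (p : MvPolynomial (Fin m) ℂ)
    (x : EuclideanSpace ℝ (Fin m)) :
    HasLineDerivAt ℝ (fun x : EuclideanSpace ℝ (Fin m) => eval (fun i => ((x i : ℝ) : ℂ)) p)
      (eval (fun i => ((x i : ℝ) : ℂ)) (pderiv i p)) x (EuclideanSpace.single i (1 : ℝ)) := by
  induction p using MvPolynomial.induction_on with
  | C a => simpa [HasLineDerivAt] using hasDerivAt_const (0 : ℝ) a
  | add p q hp hq => simpa only [HasLineDerivAt, map_add] using HasDerivAt.fun_add hp hq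
  | mul_X p j hp =>
    have hX : HasDerivAt (fun t : ℝ => (((x + t • EuclideanSpace.single i (1 : ℝ)) j : ℝ) : ℂ))
        (if j = i then 1 else 0) 0 := by
      have h : HasDerivAt (fun t : ℝ => (x j + t * (if j = i then 1 else 0) : ℝ))
          (if j = i then 1 else 0) 0 := by
        simpa using ((hasDerivAt_id (0 : ℝ)).mul_const (if j = i then (1 : ℝ) else 0)).const_add (x j)
      have := h.ofReal_comp
      convert this using 1
      · ext t; simp
      · split_ifs <;> simp
    have := HasDerivAt.fun_mul hp hX
    simp only [HasLineDerivAt, eval_mul, eval_X]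
    refine this.congr_deriv ?_
    rw [pderiv_mul, pderiv_X, Pi.single_apply, eval_add, eval_mul, eval_mul, eval_X]
    split_ifs with h1 <;> simp

theorem hasLineDerivAt_gaussian (i : Fin m) (x : EuclideanSpace ℝ (Fin m)) :
    HasLineDerivAt ℝ (fun x : EuclideanSpace ℝ (Fin m) => (Real.exp (-‖x‖ ^ 2 / 2) : ℂ))
      (-((x i : ℝ) : ℂ) * (Real.exp (-‖x‖ ^ 2 / 2) : ℂ)) x (EuclideanSpace.single i (1 : ℝ)) := by
  have h1 : HasFDerivAt (fun x : EuclideanSpace ℝ (Fin m) => ‖x‖ ^ 2) (2 • innerSL ℝ x) x :=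
    (hasStrictFDerivAt_norm_sq x).hasFDerivAt
  have h2 := (h1.hasLineDerivAt (EuclideanSpace.single i (1 : ℝ)))
  have h3 : HasDerivAt (fun t : ℝ => ‖x + t • EuclideanSpace.single i (1 : ℝ)‖ ^ 2) (2 * x i) 0 := by
    simpa [HasLineDerivAt, EuclideanSpace.inner_single_right] using h2
  have h4 := ((h3.neg.div_const 2).exp).ofReal_comp
  refine HasDerivAt.congr_deriv h4 ?_
  simp
  ring

theorem partialOp_gaussPoly (i : Fin m) (p : MvPolynomial (Fin m) ℂ) :
    partialOp m i (gaussPoly m p) = gaussPoly m (pderiv i p - X i * p) := by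
  ext x
  rw [partialOp_apply, gaussPoly_apply]
  have h := HasDerivAt.fun_mul (hasLineDerivAt_eval i p x) (hasLineDerivAt_gaussian i x)
  have h' := show HasLineDerivAt ℝ (gaussPoly m p) _ x (EuclideanSpace.single i (1 : ℝ)) by
    have e : (gaussPoly m p : EuclideanSpace ℝ (Fin m) → ℂ) = fun x =>
      eval (fun i => ((x i : ℝ) : ℂ)) p * (Real.exp (-‖x‖ ^ 2 / 2) : ℂ) :=
      funext (gaussPoly_apply p)
    rw [e]
    exact h
  rw [h'.lineDeriv]
  simp
  ring

theorem lapOp_eq_sum : lapOp m = ∑ i, partialOp m i * partialOp m i := by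
  ext1 f
  rw [lapOp, SchwartzMap.laplacianCLM_eq,
    SchwartzMap.laplacian_eq_sum (EuclideanSpace.basisFun (Fin m) ℝ)]
  simp [partialOp]

theorem normSqOp_eq_sum : normSqOp m = ∑ i, coordOp m i * coordOp m i := by
  ext f x
  rw [normSqOp_apply, sum_apply, sum_apply]
  simp only [mul_apply_eq_comp, coordOp_apply, EuclideanSpace.norm_sq_eq]
  simp [Finset.sum_mul]
  exact Finset.sum_congr rfl fun i _ => by ring

theorem partialOp_apply_eq_fderiv (i : Fin m) (f : SchwartzSpace m)
    (x : EuclideanSpace ℝ (Fin m)) :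
    partialOp m i f x = fderiv ℝ f x (EuclideanSpace.single i (1 : ℝ)) := by
  rw [partialOp, LineDeriv.lineDerivOpCLM_apply, SchwartzMap.lineDerivOp_apply_eq_fderiv]

theorem partialOp_mul_partialOp (i j : Fin m) :
    partialOp m i * partialOp m j = partialOp m j * partialOp m i := by
  have key (i j : Fin m) (f : SchwartzSpace m) (x : EuclideanSpace ℝ (Fin m)) :
      partialOp m i (partialOp m j f) x = fderiv ℝ (fderiv ℝ f) x (EuclideanSpace.single i 1)
        (EuclideanSpace.single j 1) := by
    rw [partialOp_apply_eq_fderiv, show (partialOp m j f : EuclideanSpace ℝ (Fin m) → ℂ) =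
      fun y => fderiv ℝ f y (EuclideanSpace.single j 1) from
      funext (partialOp_apply_eq_fderiv j f)]
    have hd : DifferentiableAt ℝ (fderiv ℝ f) x :=
      ((f.smooth 2).fderiv_right (m := 1) le_rfl).differentiable (by simp) x
    rw [fderiv_clm_apply hd (by fun_prop)]
    simp
  ext f x
  rw [mul_apply_eq_comp, mul_apply_eq_comp, key, key]
  exact ((f.smooth 2).contDiffAt.isSymmSndFDerivAt (by simp)).eq _ _

theorem coordOp_mul_coordOp (i j : Fin m) :
    coordOp m i * coordOp m j = coordOp m j * coordOp m i := by
  ext f x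
  simp only [mul_apply_eq_comp, coordOp_apply]
  ring

theorem partialOp_mul_coordOp (i j : Fin m) :
    partialOp m i * coordOp m j = coordOp m j * partialOp m i + if i = j then 1 else 0 := by
  ext f x
  have h1 : HasFDerivAt (fun x : EuclideanSpace ℝ (Fin m) => ((x j : ℝ) : ℂ))
      (Complex.ofRealCLM ∘L (EuclideanSpace.proj j : EuclideanSpace ℝ (Fin m) →L[ℝ] ℝ)) x :=
    (Complex.ofRealCLM ∘L (EuclideanSpace.proj j : EuclideanSpace ℝ (Fin m) →L[ℝ] ℝ)
      ).hasFDerivAt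
  have h2 := h1.fun_mul (f.hasFDerivAt x)
  have h3 : (coordOp m j f : EuclideanSpace ℝ (Fin m) → ℂ) = fun x => ((x j : ℝ) : ℂ) * f x :=
    funext (coordOp_apply m j f)
  rw [mul_apply_eq_comp, partialOp_apply_eq_fderiv, h3, h2.fderiv, add_apply, add_apply,
    add_apply, mul_apply_eq_comp, coordOp_apply, partialOp_apply_eq_fderiv]
  rcases eq_or_ne i j with rfl | h
  · simp
  · simp [h, h.symm]

end Gaussian

/-! ### The sl(2) operators conjugated by the Gaussian to operators on polynomials. -/

noncomputable section PolynomialOperators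

open MvPolynomial

variable {m : ℕ}

theorem pderiv_pderiv_comm {σ R : Type*} [CommSemiring R] (i j : σ) (p : MvPolynomial σ R) :
    pderiv i (pderiv j p) = pderiv j (pderiv i p) := by
  classical
  induction p using MvPolynomial.induction_on with
  | C a => simp
  | add p q hp hq => simp [hp, hq]
  | mul_X p k hp =>
    simp only [pderiv_mul, map_add, pderiv_X, hp, Pi.single_apply]
    split_ifs <;> (simp; try ring)

/-- The Laplace operator on polynomials. -/
def polyLap (m : ℕ) : MvPolynomial (Fin m) ℂ →ₗ[ℂ] MvPolynomial (Fin m) ℂ :=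
  ∑ i, (pderiv i).toLinearMap ∘ₗ (pderiv i).toLinearMap

/-- The Euler operator on polynomials. -/
def polyEuler (m : ℕ) : MvPolynomial (Fin m) ℂ →ₗ[ℂ] MvPolynomial (Fin m) ℂ :=
  ∑ i, LinearMap.mulLeft ℂ (X i) ∘ₗ (pderiv i).toLinearMap

/-- The polynomial `|x|²`. -/
def sqNormPoly (m : ℕ) : MvPolynomial (Fin m) ℂ := ∑ i, X i * X i

theorem polyLap_apply (p : MvPolynomial (Fin m) ℂ) :
    polyLap m p = ∑ i, pderiv i (pderiv i p) := by
  simp [polyLap]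

theorem polyEuler_apply (p : MvPolynomial (Fin m) ℂ) :
    polyEuler m p = ∑ i, X i * pderiv i p := by
  simp [polyEuler]

theorem isHomogeneous_sqNormPoly : (sqNormPoly m).IsHomogeneous 2 :=
  IsHomogeneous.sum _ _ _ fun i _ => (isHomogeneous_X ℂ i).mul (isHomogeneous_X ℂ i)

theorem eval_sqNormPoly (x : EuclideanSpace ℝ (Fin m)) :
    eval (fun i => ((x i : ℝ) : ℂ)) (sqNormPoly m) = ((‖x‖ ^ 2 : ℝ) : ℂ) := by
  rw [EuclideanSpace.norm_sq_eq]
  simp [sqNormPoly, pow_two]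

theorem pderiv_sqNormPoly (i : Fin m) : pderiv i (sqNormPoly m) = 2 * X i := by
  simp only [sqNormPoly, map_sum, pderiv_mul, pderiv_X]
  rw [Finset.sum_eq_single i]
  · simp; ring
  · intro j _ hj; simp [hj]
  · simp

theorem pderiv_polyEuler (i : Fin m) (p : MvPolynomial (Fin m) ℂ) :
    pderiv i (polyEuler m p) = pderiv i p + polyEuler m (pderiv i p) := by
  have h (j : Fin m) : pderiv i (X j * pderiv j p) =
      (if j = i then pderiv j p else 0) + X j * pderiv j (pderiv i p) := by
    rw [pderiv_mul, pderiv_X, Pi.single_apply, pderiv_pderiv_comm i j]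
    split_ifs <;> simp
  rw [polyEuler_apply, map_sum]
  simp only [h, Finset.sum_add_distrib, Finset.sum_ite_eq', Finset.mem_univ, if_true,
    polyEuler_apply]

theorem pderiv_polyLap (i : Fin m) (p : MvPolynomial (Fin m) ℂ) :
    pderiv i (polyLap m p) = polyLap m (pderiv i p) := by
  simp only [polyLap_apply, map_sum]
  exact Finset.sum_congr rfl fun j _ => by rw [pderiv_pderiv_comm, pderiv_pderiv_comm i j]

theorem polyLap_polyEuler (p : MvPolynomial (Fin m) ℂ) :
    polyLap m (polyEuler m p) = (2 : ℂ) • polyLap m p + polyEuler m (polyLap m p) := by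
  rw [polyLap_apply (polyEuler m p)]
  simp only [pderiv_polyEuler, map_add, Finset.sum_add_distrib]
  rw [polyLap_apply, map_sum]
  module

theorem polyLap_sqNormPoly_mul (p : MvPolynomial (Fin m) ℂ) :
    polyLap m (sqNormPoly m * p) = (2 * m : ℂ) • p + (4 : ℂ) • polyEuler m p
      + sqNormPoly m * polyLap m p := by
  have h (i : Fin m) : pderiv i (pderiv i (sqNormPoly m * p)) =
      (2 : ℂ) • p + (4 : ℂ) • (X i * pderiv i p) + sqNormPoly m * pderiv i (pderiv i p) := by
    have h2 : pderiv i (2 : MvPolynomial (Fin m) ℂ) = 0 := pderiv_C (a := (2 : ℂ))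
    rw [pderiv_mul, pderiv_sqNormPoly, map_add, pderiv_mul, pderiv_mul, pderiv_mul, h2,
      pderiv_X_self, pderiv_sqNormPoly, smul_eq_C_mul, smul_eq_C_mul, map_ofNat, map_ofNat]
    ring
  rw [polyLap_apply]
  simp only [h, Finset.sum_add_distrib]
  rw [← Finset.smul_sum, ← Finset.smul_sum, ← polyEuler_apply, ← Finset.mul_sum, ← polyLap_apply]
  congr 2
  simp [← Nat.cast_smul_eq_nsmul ℂ, smul_smul, mul_comm]

theorem polyEuler_of_isHomogeneous {p : MvPolynomial (Fin m) ℂ} {n : ℕ} (h : p.IsHomogeneous n) :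
    polyEuler m p = (n : ℂ) • p := by
  rw [polyEuler_apply, h.sum_X_mul_pderiv, Nat.cast_smul_eq_nsmul]

/-! The operators of the oscillator representation on `p(x) e^{-|x|²/2}`. -/

theorem normSqOp_gaussPoly (p : MvPolynomial (Fin m) ℂ) :
    normSqOp m (gaussPoly m p) = gaussPoly m (sqNormPoly m * p) := by
  rw [normSqOp_eq_sum, sum_apply, sqNormPoly, Finset.sum_mul, map_sum]
  exact Finset.sum_congr rfl fun i _ => by
    rw [mul_apply_eq_comp, coordOp_gaussPoly, coordOp_gaussPoly, mul_assoc]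

theorem eulerOp_gaussPoly (p : MvPolynomial (Fin m) ℂ) :
    eulerOp m (gaussPoly m p) = gaussPoly m (polyEuler m p - sqNormPoly m * p) := by
  rw [eulerOp, sum_apply, polyEuler_apply, sqNormPoly, Finset.sum_mul, ← Finset.sum_sub_distrib,
    map_sum]
  exact Finset.sum_congr rfl fun i _ => by
    rw [mul_apply_eq_comp, partialOp_gaussPoly, coordOp_gaussPoly, mul_sub, mul_assoc]

theorem lapOp_gaussPoly (p : MvPolynomial (Fin m) ℂ) :
    lapOp m (gaussPoly m p) = gaussPoly m (polyLap m p - (2 : ℂ) • polyEuler m p - (m : ℂ) • p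
      + sqNormPoly m * p) := by
  have h (i : Fin m) : (partialOp m i * partialOp m i) (gaussPoly m p) =
      gaussPoly m (pderiv i (pderiv i p) - (2 : ℂ) • (X i * pderiv i p) - p + X i * X i * p) := by
    rw [mul_apply_eq_comp, partialOp_gaussPoly, partialOp_gaussPoly]
    congr 1
    rw [map_sub (pderiv (R := ℂ) i), pderiv_mul, pderiv_X_self, smul_eq_C_mul, map_ofNat]
    ring
  rw [lapOp_eq_sum, sum_apply]
  simp only [h]
  rw [← map_sum, Finset.sum_add_distrib, Finset.sum_sub_distrib, Finset.sum_sub_distrib,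
    ← polyLap_apply, ← Finset.smul_sum, ← polyEuler_apply, ← Finset.sum_mul, ← sqNormPoly]
  simp [← Nat.cast_smul_eq_nsmul ℂ]

theorem hOp_gaussPoly (p : MvPolynomial (Fin m) ℂ) :
    hOp m (gaussPoly m p) = gaussPoly m (polyEuler m p + (m / 2 : ℂ) • p
      - (1 / 2 : ℂ) • polyLap m p) := by
  simp only [hOp, add_apply, neg_apply, smul_apply, lapOp_gaussPoly, normSqOp_gaussPoly, map_add,
    map_sub, map_smul]
  module

theorem eOp_gaussPoly (p : MvPolynomial (Fin m) ℂ) :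
    eOp m (gaussPoly m p) = gaussPoly m (polyEuler m p + (m / 2 : ℂ) • p
      - (1 / 4 : ℂ) • polyLap m p - sqNormPoly m * p) := by
  simp only [eOp, add_apply, sub_apply, neg_apply, smul_apply, lapOp_gaussPoly,
    normSqOp_gaussPoly, eulerOp_gaussPoly, one_apply_eq_self, map_add, map_sub, map_smul]
  module

theorem fOp_gaussPoly (p : MvPolynomial (Fin m) ℂ) :
    fOp m (gaussPoly m p) = gaussPoly m ((1 / 4 : ℂ) • polyLap m p) := by
  simp only [fOp, add_apply, smul_apply, lapOp_gaussPoly,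
    normSqOp_gaussPoly, eulerOp_gaussPoly, one_apply_eq_self, map_add, map_sub, map_smul]
  module

/-- Expand with [Δ, 𝔼] = 2Δ and [Δ, |x|²] = 2m + 4𝔼; the Δ² terms of h² and 2ef + 2fe cancel. -/
theorem casimirOp_gaussPoly (p : MvPolynomial (Fin m) ℂ) :
    casimirOp m (gaussPoly m p) = gaussPoly m (polyEuler m (polyEuler m p)
      + (m - 2 : ℂ) • polyEuler m p + ((m / 2 - 1 : ℂ) ^ 2) • p
      - sqNormPoly m * polyLap m p) := by
  simp only [casimirOp, add_apply, smul_apply, one_apply_eq_self, mul_apply_eq_comp, pow_two,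
    hOp_gaussPoly, eOp_gaussPoly, fOp_gaussPoly, polyLap_polyEuler, polyLap_sqNormPoly_mul,
    map_add, map_sub, map_smul]
  module

end PolynomialOperators

/-! ### Harmonic decomposition and the eigenvalues on Hermite functions. -/

noncomputable section Harmonics

open MvPolynomial

variable {m : ℕ}

theorem isSphericalHarmonic_iff {k : ℕ} {H : MvPolynomial (Fin m) ℂ} :
    IsSphericalHarmonic k H ↔ H.IsHomogeneous k ∧ polyLap m H = 0 := by
  rw [IsSphericalHarmonic, polyLap_apply]

theorem isHomogeneous_sqNormPoly_pow_mul {k : ℕ} {H : MvPolynomial (Fin m) ℂ}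
    (hH : H.IsHomogeneous k) (a : ℕ) : (sqNormPoly m ^ a * H).IsHomogeneous (2 * a + k) :=
  (isHomogeneous_sqNormPoly.pow a).mul hH

theorem polyEuler_sqNormPoly_pow_mul {k : ℕ} {H : MvPolynomial (Fin m) ℂ}
    (hH : H.IsHomogeneous k) (a : ℕ) :
    polyEuler m (sqNormPoly m ^ a * H) = (2 * a + k : ℂ) • (sqNormPoly m ^ a * H) := by
  rw [polyEuler_of_isHomogeneous (isHomogeneous_sqNormPoly_pow_mul hH a)]
  push_cast; rfl

theorem polyLap_sqNormPoly_pow_succ_mul {k : ℕ} {H : MvPolynomial (Fin m) ℂ}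
    (hH : IsSphericalHarmonic k H) (a : ℕ) :
    polyLap m (sqNormPoly m ^ (a + 1) * H) =
      (2 * (a + 1) * (2 * a + m + 2 * k) : ℂ) • (sqNormPoly m ^ a * H) := by
  rw [isSphericalHarmonic_iff] at hH
  induction a with
  | zero =>
    rw [zero_add, pow_one, polyLap_sqNormPoly_mul, hH.2, polyEuler_of_isHomogeneous hH.1]
    simp only [pow_zero, one_mul, mul_zero]
    push_cast
    module
  | succ a ih =>
    rw [pow_succ' (sqNormPoly m) (a + 1), mul_assoc, polyLap_sqNormPoly_mul, ih,
      polyEuler_sqNormPoly_pow_mul hH.1, mul_smul_comm, ← mul_assoc, ← pow_succ']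
    push_cast
    module

theorem sqNormPoly_mul_polyLap {k : ℕ} {H : MvPolynomial (Fin m) ℂ}
    (hH : IsSphericalHarmonic k H) (a : ℕ) :
    sqNormPoly m * polyLap m (sqNormPoly m ^ a * H) =
      (2 * a * (2 * a - 2 + m + 2 * k) : ℂ) • (sqNormPoly m ^ a * H) := by
  cases a with
  | zero => simp [(isSphericalHarmonic_iff.1 hH).2]
  | succ a =>
    rw [polyLap_sqNormPoly_pow_succ_mul hH, mul_smul_comm, ← mul_assoc, ← pow_succ']
    push_cast
    ring_nf

/-- The dependence on `a` cancels between the Euler terms and |x|²Δ, so Ω sees only the harmonic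
degree. Every radial combination, in particular the Laguerre one, is therefore an eigenvector as
well. -/
theorem casimirOp_gaussPoly_sqNormPoly_pow_mul {k : ℕ} {H : MvPolynomial (Fin m) ℂ}
    (hH : IsSphericalHarmonic k H) (a : ℕ) :
    casimirOp m (gaussPoly m (sqNormPoly m ^ a * H)) =
      ((k + m / 2 - 1 : ℂ) ^ 2) • gaussPoly m (sqNormPoly m ^ a * H) := by
  rw [casimirOp_gaussPoly, sqNormPoly_mul_polyLap hH, polyEuler_sqNormPoly_pow_mul hH.1, map_smul,
    polyEuler_sqNormPoly_pow_mul hH.1, ← map_smul]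
  congr 1
  module

/-- The coefficient of `(-t)^n` in `2^j j! L_j^{m/2+k-1}(t)`. -/
def laguerreCoeff (m j k n : ℕ) : ℝ :=
  2 ^ j * j ! * (Real.Gamma (j + ((m : ℝ) / 2 + k - 1) + 1) /
    (n ! * (j - n)! * Real.Gamma (n + ((m : ℝ) / 2 + k - 1) + 1)))

/-- The polynomial factor `2^j j! L_j^{m/2+k-1}(|x|²) H(x)` of a Hermite function. -/
def hermitePoly (j k : ℕ) (H : MvPolynomial (Fin m) ℂ) : MvPolynomial (Fin m) ℂ :=
  ∑ n ∈ Finset.range (j + 1),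
    ((laguerreCoeff m j k n * (-1) ^ n : ℝ) : ℂ) • (sqNormPoly m ^ n * H)

theorem gaussPoly_hermitePoly_apply (j k : ℕ) (H : MvPolynomial (Fin m) ℂ)
    (x : EuclideanSpace ℝ (Fin m)) :
    gaussPoly m (hermitePoly j k H) x =
      ((2 ^ j * j ! * laguerreL j ((m : ℝ) / 2 + k - 1) (‖x‖ ^ 2) : ℝ) : ℂ)
        * eval (fun i => ((x i : ℝ) : ℂ)) H * (Real.exp (-‖x‖ ^ 2 / 2) : ℂ) := by
  rw [gaussPoly_apply]
  congr 1
  rw [hermitePoly, laguerreL, Finset.mul_sum, Complex.ofReal_sum, Finset.sum_mul, map_sum]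
  refine Finset.sum_congr rfl fun n _ => ?_
  rw [smul_eval, eval_mul, map_pow, eval_sqNormPoly, laguerreCoeff, neg_pow (‖x‖ ^ 2)]
  push_cast
  ring

theorem isHermiteFunction_iff {v : SchwartzSpace m} :
    IsHermiteFunction v ↔ ∃ (j k : ℕ) (H : MvPolynomial (Fin m) ℂ), IsSphericalHarmonic k H ∧
      v = gaussPoly m (hermitePoly j k H) := by
  refine exists_congr fun j => exists_congr fun k => exists_congr fun H => and_congr_right fun _ => ?_
  rw [DFunLike.ext_iff]
  exact forall_congr' fun x => by rw [gaussPoly_hermitePoly_apply]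

theorem gamma_arg_pos (hm : 0 < m) (k n : ℕ) : 0 < (n : ℝ) + ((m : ℝ) / 2 + k - 1) + 1 := by
  have : (0 : ℝ) < m := by exact_mod_cast hm
  ring_nf
  positivity

theorem laguerreCoeff_succ (hm : 0 < m) {j k n : ℕ} (hn : n < j) :
    laguerreCoeff m j k (n + 1) * ((n + 1) * (2 * n + m + 2 * k)) =
      2 * (j - n) * laguerreCoeff m j k n := by
  have hp := gamma_arg_pos hm k n
  have h1 : ((n + 1 : ℕ) : ℝ) + ((m : ℝ) / 2 + k - 1) + 1 =
      ((n : ℝ) + ((m : ℝ) / 2 + k - 1) + 1) + 1 := by push_cast; ring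
  have h2 : j - n = (j - (n + 1)) + 1 := by omega
  have h3 : (((j - (n + 1) : ℕ) : ℝ)) = j - n - 1 := by rw [Nat.cast_sub (by omega)]; push_cast; ring
  have h4 := (Real.Gamma_pos_of_pos hp).ne'
  have h5 : (j : ℝ) - n ≠ 0 := by
    have : (n : ℝ) < j := by exact_mod_cast hn
    linarith
  have h6 : (((j - (n + 1))! : ℕ) : ℝ) ≠ 0 := by positivity
  have h7 : ((n ! : ℕ) : ℝ) ≠ 0 := by positivity
  have h8 : (n : ℝ) + 1 ≠ 0 := by positivity
  rw [laguerreCoeff, laguerreCoeff, h1, Real.Gamma_add_one hp.ne', h2, Nat.factorial_succ,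
    Nat.factorial_succ]
  push_cast
  rw [h3]
  have h9 : (j : ℝ) - n - 1 + 1 = j - n := by ring
  have h10 : (2 * n + m + 2 * k : ℝ) = 2 * ((n : ℝ) + ((m : ℝ) / 2 + k - 1) + 1) := by ring
  rw [h9, h10]
  generalize (n : ℝ) + ((m : ℝ) / 2 + k - 1) + 1 = s at *
  have h11 := hp.ne'
  field_simp

/-- Comparing coefficients of |x|^(2n) H, the eigenvalue equation is exactly the Laguerre recurrence
`laguerreCoeff_succ`; the top term n = j receives nothing from Δ. -/
theorem polyEuler_sub_polyLap_hermitePoly (hm : 0 < m) (j : ℕ) {k : ℕ}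
    {H : MvPolynomial (Fin m) ℂ} (hH : IsSphericalHarmonic k H) :
    polyEuler m (hermitePoly j k H) - (1 / 2 : ℂ) • polyLap m (hermitePoly j k H) =
      ((k + 2 * j : ℕ) : ℂ) • hermitePoly j k H := by
  have hE : polyEuler m (hermitePoly j k H) = ∑ n ∈ Finset.range (j + 1),
      ((laguerreCoeff m j k n * (-1) ^ n : ℝ) : ℂ) • (2 * n + k : ℂ) • (sqNormPoly m ^ n * H) := by
    rw [hermitePoly, map_sum]
    exact Finset.sum_congr rfl fun n _ => by rw [map_smul, polyEuler_sqNormPoly_pow_mul hH.1]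
  have hL : polyLap m (hermitePoly j k H) = ∑ n ∈ Finset.range j,
      ((laguerreCoeff m j k (n + 1) * (-1) ^ (n + 1) : ℝ) : ℂ) •
        (2 * (n + 1) * (2 * n + m + 2 * k) : ℂ) • (sqNormPoly m ^ n * H) := by
    rw [hermitePoly, map_sum, Finset.sum_range_succ', map_smul]
    simp only [pow_zero, one_mul, (isSphericalHarmonic_iff.1 hH).2, smul_zero, add_zero]
    exact Finset.sum_congr rfl fun n _ => by rw [map_smul, polyLap_sqNormPoly_pow_succ_mul hH]
  rw [hE, hL, hermitePoly, Finset.sum_range_succ, Finset.sum_range_succ, smul_add,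
    Finset.smul_sum, Finset.smul_sum, add_sub_right_comm, ← Finset.sum_sub_distrib]
  congr 1
  · refine Finset.sum_congr rfl fun n hn => ?_
    have h := laguerreCoeff_succ hm (k := k) (Finset.mem_range.1 hn)
    have h' : (laguerreCoeff m j k (n + 1) : ℂ) * ((n + 1) * (2 * n + m + 2 * k)) =
      2 * (j - n) * (laguerreCoeff m j k n : ℂ) := by exact_mod_cast congrArg Complex.ofReal h
    rw [smul_smul, smul_smul, smul_smul, smul_smul, ← sub_smul]
    congr 1
    push_cast
    linear_combination (-1 : ℂ) ^ n * h'
  · rw [smul_smul, smul_smul]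
    congr 1
    push_cast
    ring

theorem hOp_gaussPoly_hermitePoly (hm : 0 < m) (j : ℕ) {k : ℕ}
    {H : MvPolynomial (Fin m) ℂ} (hH : IsSphericalHarmonic k H) :
    hOp m (gaussPoly m (hermitePoly j k H)) =
      (m / 2 + (k + 2 * j : ℕ) : ℂ) • gaussPoly m (hermitePoly j k H) := by
  have h := polyEuler_sub_polyLap_hermitePoly hm j hH
  rw [hOp_gaussPoly, add_sub_right_comm, h, ← map_smul]
  congr 1
  module

theorem casimirOp_gaussPoly_hermitePoly (j : ℕ) {k : ℕ}
    {H : MvPolynomial (Fin m) ℂ} (hH : IsSphericalHarmonic k H) :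
    casimirOp m (gaussPoly m (hermitePoly j k H)) =
      ((k + m / 2 - 1 : ℂ) ^ 2) • gaussPoly m (hermitePoly j k H) := by
  rw [hermitePoly, map_sum, map_sum, Finset.smul_sum]
  refine Finset.sum_congr rfl fun n _ => ?_
  rw [map_smul, map_smul, casimirOp_gaussPoly_sqNormPoly_pow_mul hH, smul_comm]

/-! Polynomials are generated by the `|x|^{2a} H` with `H` harmonic. -/

theorem exists_polyLap_eq_of_mem_span (hm : 0 < m) (N : ℕ) {q : MvPolynomial (Fin m) ℂ}
    (hq : q ∈ Submodule.span ℂ {p | ∃ a k H, 2 * a + k = N ∧ IsSphericalHarmonic k H ∧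
      p = sqNormPoly m ^ a * H}) :
    ∃ r ∈ Submodule.span ℂ {p | ∃ a k H, 2 * a + k = N + 2 ∧ IsSphericalHarmonic k H ∧
      p = sqNormPoly m ^ a * H}, polyLap m r = q := by
  induction hq using Submodule.span_induction with
  | mem q hq =>
    obtain ⟨a, k, H, h, hH, rfl⟩ := hq
    have hc : (2 * (a + 1) * (2 * a + m + 2 * k) : ℂ) ≠ 0 := by
      have : 2 * (a + 1) * (2 * a + m + 2 * k) ≠ 0 := by positivity
      exact_mod_cast this
    refine ⟨(2 * (a + 1) * (2 * a + m + 2 * k) : ℂ)⁻¹ • (sqNormPoly m ^ (a + 1) * H),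
      Submodule.smul_mem _ _ (Submodule.subset_span ⟨a + 1, k, H, by omega, hH, rfl⟩), ?_⟩
    rw [map_smul, polyLap_sqNormPoly_pow_succ_mul hH, smul_smul, inv_mul_cancel₀ hc, one_smul]
  | zero => exact ⟨0, Submodule.zero_mem _, map_zero _⟩
  | add p q _ _ hp hq =>
    obtain ⟨r, hr, rfl⟩ := hp
    obtain ⟨s, hs, rfl⟩ := hq
    exact ⟨r + s, Submodule.add_mem _ hr hs, map_add _ _ _⟩
  | smul c p _ hp =>
    obtain ⟨r, hr, rfl⟩ := hp
    exact ⟨c • r, Submodule.smul_mem _ _ hr, map_smul _ _ _⟩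

theorem isHomogeneous_polyLap {N : ℕ} {q : MvPolynomial (Fin m) ℂ}
    (hq : q.IsHomogeneous (N + 2)) : (polyLap m q).IsHomogeneous N := by
  rw [polyLap_apply]
  exact IsHomogeneous.sum _ _ _ fun i _ => hq.pderiv.pderiv

/-- Induction in steps of two: Δq decomposes by hypothesis, and Δ sends |x|^(2a+2) H to a nonzero
multiple of |x|^(2a) H, so some decomposed r has Δr = Δq. The difference q - r is harmonic. -/
theorem mem_span_sqNormPoly_pow_mul (hm : 0 < m) (N : ℕ) :
    ∀ q : MvPolynomial (Fin m) ℂ, q.IsHomogeneous N →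
    q ∈ Submodule.span ℂ {p | ∃ a k H, 2 * a + k = N ∧ IsSphericalHarmonic k H ∧
      p = sqNormPoly m ^ a * H} := by
  induction N using Nat.twoStepInduction with
  | zero =>
    intro q hq
    refine Submodule.subset_span ⟨0, 0, q, rfl, isSphericalHarmonic_iff.2 ⟨hq, ?_⟩, by simp⟩
    rw [← totalDegree_zero_iff_isHomogeneous, totalDegree_eq_zero_iff_eq_C] at hq
    rw [hq, polyLap_apply]
    simp
  | one =>
    intro q hq
    refine Submodule.subset_span ⟨0, 1, q, rfl, isSphericalHarmonic_iff.2 ⟨hq, ?_⟩, by simp⟩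
    rw [polyLap_apply]
    refine Finset.sum_eq_zero fun i _ => ?_
    have h := hq.pderiv (i := i)
    rw [Nat.sub_self, ← totalDegree_zero_iff_isHomogeneous, totalDegree_eq_zero_iff_eq_C] at h
    rw [h, pderiv_C]
  | more N ih _ =>
    intro q hq
    obtain ⟨r, hr, hrq⟩ := exists_polyLap_eq_of_mem_span hm N (ih _ (isHomogeneous_polyLap hq))
    have hr' : r.IsHomogeneous (N + 2) := by
      rw [← mem_homogeneousSubmodule]
      refine Submodule.span_le.2 ?_ hr
      rintro _ ⟨a, k, H, h, hH, rfl⟩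
      rw [SetLike.mem_coe, mem_homogeneousSubmodule, ← h]
      exact isHomogeneous_sqNormPoly_pow_mul hH.1 a
    rw [← sub_add_cancel q r]
    refine Submodule.add_mem _ (Submodule.subset_span ⟨0, N + 2, q - r, by simp, ?_, by simp⟩) hr
    exact isSphericalHarmonic_iff.2 ⟨hq.sub hr', by rw [map_sub, hrq, sub_self]⟩

theorem span_sqNormPoly_pow_mul_eq_top (hm : 0 < m) :
    Submodule.span ℂ {p : MvPolynomial (Fin m) ℂ | ∃ a k H, IsSphericalHarmonic k H ∧
      p = sqNormPoly m ^ a * H} = ⊤ := by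
  rw [eq_top_iff]
  rintro q -
  rw [← sum_homogeneousComponent q]
  refine Submodule.sum_mem _ fun N _ => ?_
  refine Submodule.span_mono ?_
    (mem_span_sqNormPoly_pow_mul hm N _ (homogeneousComponent_isHomogeneous N q))
  rintro p ⟨a, k, H, -, hH, rfl⟩
  exact ⟨a, k, H, hH, rfl⟩

theorem laguerreCoeff_self_pos (hm : 0 < m) (j k : ℕ) : 0 < laguerreCoeff m j k j := by
  have := Real.Gamma_pos_of_pos (gamma_arg_pos hm k j)
  rw [laguerreCoeff]
  positivity

/-- The change of basis from powers of |x|² to Laguerre polynomials is triangular with nonzero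
diagonal. -/
theorem sqNormPoly_pow_mul_mem_span (hm : 0 < m) {k : ℕ} {H : MvPolynomial (Fin m) ℂ}
    (a : ℕ) : sqNormPoly m ^ a * H ∈
      Submodule.span ℂ (Set.range fun j => hermitePoly j k H) := by
  induction a using Nat.strong_induction_on with
  | _ a ih =>
  have hc : ((laguerreCoeff m a k a * (-1) ^ a : ℝ) : ℂ) ≠ 0 := by
    have := laguerreCoeff_self_pos hm a k
    rw [Complex.ofReal_ne_zero]
    exact mul_ne_zero this.ne' (pow_ne_zero _ (by norm_num))
  have h := Finset.sum_range_succ (fun n =>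
    ((laguerreCoeff m a k n * (-1) ^ n : ℝ) : ℂ) • (sqNormPoly m ^ n * H)) a
  rw [← hermitePoly] at h
  rw [← Submodule.smul_mem_iff _ hc, ← sub_eq_of_eq_add' h]
  exact Submodule.sub_mem _ (Submodule.subset_span ⟨a, rfl⟩) (Submodule.sum_mem _ fun n hn =>
    Submodule.smul_mem _ _ (ih n (Finset.mem_range.1 hn)))

theorem span_isHermiteFunction (hm : 0 < m) :
    Submodule.span ℂ {v : SchwartzSpace m | IsHermiteFunction v} = LinearMap.range (gaussPoly m) := by
  refine le_antisymm (Submodule.span_le.2 ?_) ?_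
  · rintro v hv
    obtain ⟨j, k, H, -, rfl⟩ := isHermiteFunction_iff.1 hv
    exact ⟨_, rfl⟩
  · rw [LinearMap.range_eq_map, ← span_sqNormPoly_pow_mul_eq_top hm, Submodule.map_span,
      Submodule.span_le]
    rintro _ ⟨_, ⟨a, k, H, hH, rfl⟩, rfl⟩
    have h := Submodule.mem_map_of_mem (f := gaussPoly m)
      (sqNormPoly_pow_mul_mem_span hm (k := k) (H := H) a)
    rw [Submodule.map_span] at h
    refine Submodule.span_mono ?_ h
    rintro _ ⟨_, ⟨j, rfl⟩, rfl⟩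
    exact isHermiteFunction_iff.2 ⟨j, k, H, hH, rfl⟩

end Harmonics

/-! ### Creation operators generate the eigenspaces of h from the Gaussian. -/

noncomputable section Ladder

open MvPolynomial

variable {m : ℕ}

theorem coeff_polyEuler (p : MvPolynomial (Fin m) ℂ) (d : Fin m →₀ ℕ) :
    (polyEuler m p).coeff d = d.degree * p.coeff d := by
  induction p using MvPolynomial.induction_on' with
  | add p q hp hq => rw [map_add, coeff_add, coeff_add, hp, hq, mul_add]
  | monomial e c =>
    rw [polyEuler_of_isHomogeneous (isHomogeneous_monomial c rfl), coeff_smul, coeff_monomial]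
    split_ifs with h
    · rw [h, smul_eq_mul]
    · simp

theorem coeff_polyLap_eq_zero {p : MvPolynomial (Fin m) ℂ} {d : Fin m →₀ ℕ}
    (h : p.totalDegree ≤ d.degree) : (polyLap m p).coeff d = 0 := by
  rw [polyLap_apply, coeff_sum]
  refine Finset.sum_eq_zero fun i _ => ?_
  rw [coeff_pderiv, coeff_pderiv, coeff_eq_zero_of_totalDegree_lt, zero_mul, zero_mul]
  change p.totalDegree < (d + Finsupp.single i 1 + Finsupp.single i 1).degree
  rw [map_add, map_add, Finsupp.degree_single]
  omega

/-- Δ lowers the degree, so at a monomial of top degree the equation says that this degree is zero.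
-/
theorem eq_C_of_polyEuler_sub_polyLap_eq_zero {p : MvPolynomial (Fin m) ℂ}
    (h : polyEuler m p - (1 / 2 : ℂ) • polyLap m p = 0) : ∃ c : ℂ, p = C c := by
  refine ⟨_, totalDegree_eq_zero_iff_eq_C.1 ?_⟩
  rcases eq_or_ne p 0 with rfl | hp
  · exact totalDegree_zero
  obtain ⟨d, hd, hdeg⟩ := Finset.exists_mem_eq_sup p.support (support_nonempty.2 hp)
    (fun s => s.sum fun _ e => e)
  have h1 : d.degree = p.totalDegree := hdeg.symm
  have h2 := congrArg (coeff d) h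
  rw [coeff_sub, coeff_polyEuler, coeff_smul, coeff_polyLap_eq_zero h1.ge, smul_zero, sub_zero,
    coeff_zero, mul_eq_zero, or_iff_left (mem_support_iff.1 hd)] at h2
  rw [← h1]
  exact_mod_cast h2

/-- The creation operator `x_i - ∂_i`. -/
def creationOp (m : ℕ) (i : Fin m) : SchwartzOp m := coordOp m i - partialOp m i

theorem creationOp_gaussPoly (i : Fin m) (p : MvPolynomial (Fin m) ℂ) :
    creationOp m i (gaussPoly m p) = gaussPoly m ((2 : ℂ) • (X i * p) - pderiv i p) := by
  rw [creationOp, sub_apply, coordOp_gaussPoly, partialOp_gaussPoly, ← map_sub]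
  congr 1
  module

/-- An operator that fixes the Gaussian and commutes with the creation operators up to the scalar
`ω` acts by powers of `ω` on the eigenfunctions of `h`. -/
theorem apply_gaussPoly_of_creationOp {A : SchwartzOp m} {ω : ℂ}
    (hA : ∀ i u, A (creationOp m i u) = ω • creationOp m i (A u))
    (hg : A (gaussian m) = gaussian m) (N : ℕ) :
    ∀ p : MvPolynomial (Fin m) ℂ,
      polyEuler m p - (1 / 2 : ℂ) • polyLap m p = (N : ℂ) • p →
      A (gaussPoly m p) = ω ^ N • gaussPoly m p := by
  induction N with
  | zero =>
    intro p hp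
    obtain ⟨c, rfl⟩ := eq_C_of_polyEuler_sub_polyLap_eq_zero (hp.trans (by simp))
    rw [C_eq_smul_one, map_smul, map_smul, gaussPoly_one, hg, pow_zero, one_smul]
  | succ N ih =>
    intro p hp
    have h1 (i : Fin m) : polyEuler m (pderiv i p) - (1 / 2 : ℂ) • polyLap m (pderiv i p) =
        (N : ℂ) • pderiv i p := by
      have := congrArg (pderiv i) hp
      rw [map_sub (pderiv (R := ℂ) i), pderiv_polyEuler, (pderiv i).map_smul, (pderiv i).map_smul,
        pderiv_polyLap] at this
      rw [Nat.cast_succ, add_smul, one_smul, add_comm ((N : ℂ) • _), add_sub_assoc] at this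
      exact add_left_cancel this
    have hN : ((N + 1 : ℕ) : ℂ) ≠ 0 := by exact_mod_cast N.succ_ne_zero
    -- Creation applied to the multiple of the Gaussian by ∂_i p produces 2 X_i ∂_i p - ∂_i² p,
    -- which sums to (2𝔼 - Δ)p. By `h1` each ∂_i p has eigenvalue N, so the induction hypothesis
    -- applies to it.
    have h2 : ((N + 1 : ℕ) : ℂ) • gaussPoly m p =
        (1 / 2 : ℂ) • ∑ i, creationOp m i (gaussPoly m (pderiv i p)) := by
      simp only [creationOp_gaussPoly]
      rw [← map_smul, ← hp, ← map_sum, Finset.sum_sub_distrib, ← Finset.smul_sum,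
        ← polyEuler_apply, ← polyLap_apply, ← map_smul (gaussPoly m), smul_sub, smul_smul]
      norm_num
    have h3 : ((N + 1 : ℕ) : ℂ) • A (gaussPoly m p) =
        ((N + 1 : ℕ) : ℂ) • (ω ^ (N + 1) • gaussPoly m p) := by
      rw [smul_comm _ (ω ^ (N + 1)), ← map_smul, h2, map_smul, map_sum, smul_comm (ω ^ (N + 1)),
        Finset.smul_sum (r := ω ^ (N + 1))]
      congr 1
      refine Finset.sum_congr rfl fun i _ => ?_
      rw [hA, ih _ (h1 i), map_smul, smul_smul, pow_succ']
    exact smul_right_injective _ hN h3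

end Ladder

/-! ### The unitary Fourier transforms and the integral operator. -/

noncomputable section FourierOperators

variable {m : ℕ}

/-- The dilation `u ↦ u(c ·)` on `𝓢(ℝ^m)`. -/
def dilationOp (m : ℕ) (c : ℝˣ) : SchwartzOp m :=
  SchwartzMap.compCLMOfContinuousLinearEquiv ℂ (ContinuousLinearEquiv.smulLeft c)

theorem dilationOp_apply (c : ℝˣ) (u : SchwartzSpace m) (x : EuclideanSpace ℝ (Fin m)) :
    dilationOp m c u x = u ((c : ℝ) • x) := rfl

theorem dilationOp_coordOp (c : ℝˣ) (i : Fin m) (u : SchwartzSpace m) :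
    dilationOp m c (coordOp m i u) = (c : ℂ) • coordOp m i (dilationOp m c u) := by
  ext x
  rw [smul_apply, dilationOp_apply, coordOp_apply, coordOp_apply, dilationOp_apply]
  simp [mul_assoc]

theorem partialOp_dilationOp (c : ℝˣ) (i : Fin m) (u : SchwartzSpace m) :
    partialOp m i (dilationOp m c u) = (c : ℂ) • dilationOp m c (partialOp m i u) := by
  ext x
  have h : HasFDerivAt (dilationOp m c u)
      ((fderiv ℝ u ((c : ℝ) • x)).comp ((c : ℝ) • ContinuousLinearMap.id ℝ _)) x :=
    (u.hasFDerivAt ((c : ℝ) • x)).comp x ((hasFDerivAt_id x).const_smul (c : ℝ))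
  rw [smul_apply, dilationOp_apply, partialOp_apply_eq_fderiv, partialOp_apply_eq_fderiv, h.fderiv]
  simp

theorem smulLeftCLM_inner_single (i : Fin m) (u : SchwartzSpace m) :
    SchwartzMap.smulLeftCLM ℂ (inner ℝ · (EuclideanSpace.single i (1 : ℝ))) u = coordOp m i u := by
  ext x
  rw [SchwartzMap.smulLeftCLM_apply_apply (by fun_prop), coordOp_apply]
  simp [EuclideanSpace.inner_single_right]

open FourierTransform in
theorem fourier_partialOp (i : Fin m) (u : SchwartzSpace m) :
    𝓕 (partialOp m i u) = (2 * Real.pi * Complex.I) • coordOp m i (𝓕 u) := by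
  rw [partialOp, LineDeriv.lineDerivOpCLM_apply, SchwartzMap.fourier_lineDerivOp_eq,
    smulLeftCLM_inner_single]

open FourierTransform in
theorem fourier_coordOp (i : Fin m) (u : SchwartzSpace m) :
    𝓕 (coordOp m i u) = (Complex.I / (2 * Real.pi)) • partialOp m i (𝓕 u) := by
  rw [partialOp, LineDeriv.lineDerivOpCLM_apply, SchwartzMap.lineDerivOp_fourier_eq,
    smulLeftCLM_inner_single, FourierTransform.fourier_smul, smul_smul]
  have : Complex.I / (2 * Real.pi) * -(2 * Real.pi * Complex.I) = 1 := by
    have := Real.pi_ne_zero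
    field_simp
    simp
  rw [this, one_smul]

/-- The factor `(2π)^{-m/2}`. -/
def fourierConst (m : ℕ) : ℝ := 1 / (2 * Real.pi) ^ ((m : ℝ) / 2)

/-- The unit `s / (2π)` for a sign `s`. -/
def dilationUnit (s : ℤˣ) : ℝˣ :=
  Units.map (Int.castRingHom ℝ : ℤ →* ℝ) s * (Units.mk0 (2 * Real.pi) (by positivity))⁻¹

theorem coe_dilationUnit (s : ℤˣ) : (dilationUnit s : ℝ) = ((s : ℤ) : ℝ) / (2 * Real.pi) := by
  simp [dilationUnit, div_eq_mul_inv]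

/-- The Fourier transform `u ↦ (2π)^{-m/2} ∫ e^{-i s ⟨x, ·⟩} u(x) dx` for a sign `s`. -/
def fourierOp (m : ℕ) (s : ℤˣ) : SchwartzOp m :=
  (fourierConst m : ℂ) • (dilationOp m (dilationUnit s) ∘L SchwartzMap.fourierTransformCLM ℂ)

open FourierTransform in
theorem fourierOp_apply (s : ℤˣ) (u : SchwartzSpace m) :
    fourierOp m s u = (fourierConst m : ℂ) • dilationOp m (dilationUnit s) (𝓕 u) := rfl

theorem fourierOp_apply_apply (s : ℤˣ) (u : SchwartzSpace m) (y : EuclideanSpace ℝ (Fin m)) :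
    fourierOp m s u y = fourierConst m *
      ∫ x, Complex.exp (-(Complex.I * (s : ℤ) * (inner ℝ x y : ℝ))) * u x := by
  rw [fourierOp_apply, smul_apply, dilationOp_apply, SchwartzMap.fourier_coe, Real.fourier_eq',
    smul_eq_mul, coe_dilationUnit]
  congr 2
  ext x
  rw [inner_smul_right, smul_eq_mul]
  congr 2
  have := Real.pi_ne_zero
  push_cast
  field_simp

/-- The transform exchanges x_i and ∂_i up to factors of i; the dilation by s/(2π) balances these
factors, and s² = 1 lets x_i - ∂_i reappear as a multiple of itself. -/
theorem fourierOp_creationOp (s : ℤˣ) (i : Fin m) (u : SchwartzSpace m) :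
    fourierOp m s (creationOp m i u) =
      (-Complex.I * (s : ℤ)) • creationOp m i (fourierOp m s u) := by
  rw [fourierOp_apply, fourierOp_apply, creationOp, sub_apply, sub_eq_add_neg (coordOp m i u),
    FourierTransform.fourier_add, FourierTransform.fourier_neg,
    fourier_partialOp, fourier_coordOp, map_add, map_neg, map_smul, map_smul, dilationOp_coordOp, sub_apply,
    map_smul, map_smul, partialOp_dilationOp, coe_dilationUnit]
  have hpi : (Real.pi : ℂ) ≠ 0 := by exact_mod_cast Real.pi_ne_zero
  have hs : ((s : ℤ) : ℂ) * (s : ℤ) = 1 := by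
    rcases Int.units_eq_one_or s with rfl | rfl <;> simp
  push_cast
  match_scalars
  · field_simp
    linear_combination -(fourierConst m : ℂ) * hs
  · field_simp

open FourierTransform in
theorem fourierOp_gaussian (s : ℤˣ) : fourierOp m s (gaussian m) = gaussian m := by
  ext y
  have h : (gaussian m : EuclideanSpace ℝ (Fin m) → ℂ) =
      fun x => Complex.exp (-(1 / 2 : ℂ) * (‖x‖ : ℂ) ^ 2) := by
    ext x
    rw [gaussian_apply]
    push_cast
    ring_nf
  rw [fourierOp_apply, smul_apply, dilationOp_apply, SchwartzMap.fourier_coe, h,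
    fourier_gaussian_innerProductSpace (by norm_num), norm_smul, coe_dilationUnit]
  have hs : ‖((s : ℤ) : ℝ)‖ = 1 := by
    rcases Int.units_eq_one_or s with rfl | rfl <;> simp
  have hpi : (Real.pi : ℂ) ≠ 0 := by exact_mod_cast Real.pi_ne_zero
  have h2 : (Real.pi / (1 / 2 : ℂ)) ^ ((Module.finrank ℝ (EuclideanSpace ℝ (Fin m)) : ℂ) / 2) =
      (((2 * Real.pi) ^ ((m : ℝ) / 2) : ℝ) : ℂ) := by
    rw [Complex.ofReal_cpow (by positivity), finrank_euclideanSpace_fin]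
    push_cast
    congr 1
    ring
  have h3 : (fourierConst m : ℂ) * (((2 * Real.pi) ^ ((m : ℝ) / 2) : ℝ) : ℂ) = 1 := by
    rw [fourierConst, ← Complex.ofReal_mul, one_div_mul_cancel (by positivity), Complex.ofReal_one]
  rw [h2, smul_eq_mul, ← mul_assoc, h3, one_mul, norm_div, hs]
  congr 1
  rw [Real.norm_of_nonneg (by positivity)]
  push_cast
  field_simp

theorem fourierOp_hermite (hm : 0 < m) (s : ℤˣ) (j : ℕ) {k : ℕ} {H : MvPolynomial (Fin m) ℂ}
    (hH : IsSphericalHarmonic k H) :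
    fourierOp m s (gaussPoly m (hermitePoly j k H)) =
      (-Complex.I * (s : ℤ)) ^ (k + 2 * j) • gaussPoly m (hermitePoly j k H) :=
  apply_gaussPoly_of_creationOp (fourierOp_creationOp s) (fourierOp_gaussian s) _ _
    (polyEuler_sub_polyLap_hermitePoly hm j hH)

/-- The operator with kernel `(2π)^{-m/2} (cos⟨x, y⟩ + i^{d+1} sin⟨x, y⟩)`. -/
def hartleyOp (m d : ℕ) : SchwartzOp m :=
  ((1 + Complex.I ^ d) / 2) • fourierOp m (-1) + ((1 - Complex.I ^ d) / 2) • fourierOp m 1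

/-- The two Fourier eigenvalues differ by (-1)^k, so the weights (1 ± i^d)/2 add up to 1 for even k
and subtract to i^d for odd k. -/
theorem hartleyOp_hermite (hm : 0 < m) (d j : ℕ) {k : ℕ} {H : MvPolynomial (Fin m) ℂ}
    (hH : IsSphericalHarmonic k H) :
    hartleyOp m d (gaussPoly m (hermitePoly j k H)) =
      (Complex.I ^ (k + 2 * j) * if Even k then 1 else Complex.I ^ d) •
        gaussPoly m (hermitePoly j k H) := by
  rw [hartleyOp, add_apply, smul_apply, smul_apply, fourierOp_hermite hm _ j hH,
    fourierOp_hermite hm _ j hH, smul_smul, smul_smul, ← add_smul]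
  congr 1
  simp only [Units.val_neg, Units.val_one, Int.cast_neg, Int.cast_one, mul_one, mul_neg, neg_neg]
  split_ifs with h
  · rw [Even.neg_pow (by simp [h, Nat.even_add])]
    ring
  · rw [Odd.neg_pow (by rw [Nat.not_even_iff_odd] at h; simp [h, Nat.odd_add])]
    ring

theorem hartleyKernel_eq (d : ℕ) (x y : EuclideanSpace ℝ (Fin m)) :
    hartleyKernel d x y =
      (1 + Complex.I ^ d) / 2 * Complex.exp (-(Complex.I * ((-1 : ℤˣ) : ℤ) * (inner ℝ x y : ℝ))) +
      (1 - Complex.I ^ d) / 2 * Complex.exp (-(Complex.I * ((1 : ℤˣ) : ℤ) * (inner ℝ x y : ℝ))) := by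
  have h1 : -(Complex.I * ((-1 : ℤˣ) : ℤ) * (inner ℝ x y : ℝ)) = (inner ℝ x y : ℝ) * Complex.I := by
    simp; ring
  have h2 : -(Complex.I * ((1 : ℤˣ) : ℤ) * (inner ℝ x y : ℝ)) =
      -((inner ℝ x y : ℝ) : ℂ) * Complex.I := by
    simp; ring
  rw [h1, h2, Complex.exp_mul_I, Complex.exp_mul_I, Complex.cos_neg, Complex.sin_neg,
    hartleyKernel]
  push_cast
  ring

theorem integrable_exp_mul (s : ℤˣ) (u : SchwartzSpace m) (y : EuclideanSpace ℝ (Fin m)) :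
    MeasureTheory.Integrable (fun x : EuclideanSpace ℝ (Fin m) =>
      Complex.exp (-(Complex.I * (s : ℤ) * (inner ℝ x y : ℝ))) * u x) := by
  refine u.integrable.bdd_mul (c := 1) (by fun_prop) (Filter.Eventually.of_forall fun x => ?_)
  rw [Complex.norm_exp]
  simp

theorem integrable_hartleyKernel_mul (d : ℕ) (u : SchwartzSpace m)
    (y : EuclideanSpace ℝ (Fin m)) :
    MeasureTheory.Integrable (fun x : EuclideanSpace ℝ (Fin m) => hartleyKernel d x y * u x) := by
  simp only [hartleyKernel_eq, add_mul, mul_assoc]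
  simp only [← mul_assoc (Complex.I)]
  exact ((integrable_exp_mul (-1) u y).const_mul _).add ((integrable_exp_mul 1 u y).const_mul _)

theorem hartleyOp_apply (d : ℕ) (u : SchwartzSpace m) (y : EuclideanSpace ℝ (Fin m)) :
    hartleyOp m d u y = fourierConst m * ∫ x, hartleyKernel d x y * u x := by
  have h (x : EuclideanSpace ℝ (Fin m)) : hartleyKernel d x y * u x =
      (1 + Complex.I ^ d) / 2 *
        (Complex.exp (-(Complex.I * ((-1 : ℤˣ) : ℤ) * (inner ℝ x y : ℝ))) * u x) +
      (1 - Complex.I ^ d) / 2 *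
        (Complex.exp (-(Complex.I * ((1 : ℤˣ) : ℤ) * (inner ℝ x y : ℝ))) * u x) := by
    rw [hartleyKernel_eq]; ring
  simp only [h]
  rw [MeasureTheory.integral_add ((integrable_exp_mul _ u y).const_mul _)
    ((integrable_exp_mul _ u y).const_mul _), MeasureTheory.integral_const_mul,
    MeasureTheory.integral_const_mul, hartleyOp, add_apply, add_apply, smul_apply, smul_apply,
    smul_apply, smul_apply, fourierOp_apply_apply, fourierOp_apply_apply, smul_eq_mul, smul_eq_mul]
  ring

end FourierOperators

/-! ### L² bounds for differential operators with polynomial coefficients by powers of h. -/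

noncomputable section SquareIntegrable

open MeasureTheory

variable {m : ℕ}

/-- The inclusion of `𝓢(ℝ^m)` into `L²(ℝ^m)`. -/
def toL2 (m : ℕ) : SchwartzSpace m →L[ℂ] Lp ℂ 2 (volume : Measure (EuclideanSpace ℝ (Fin m))) :=
  SchwartzMap.toLpCLM ℂ ℂ 2 volume

theorem inner_toL2 (u v : SchwartzSpace m) :
    inner ℂ (toL2 m u) (toL2 m v) = ∫ x, inner ℂ (u x) (v x) :=
  SchwartzMap.inner_toL2_toL2_eq u v volume

theorem inner_toL2_coordOp (i : Fin m) (u v : SchwartzSpace m) :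
    inner ℂ (toL2 m u) (toL2 m (coordOp m i v)) = inner ℂ (toL2 m (coordOp m i u)) (toL2 m v) := by
  rw [inner_toL2, inner_toL2]
  congr 1
  ext x
  rw [coordOp_apply, coordOp_apply]
  simp
  ring

theorem inner_toL2_partialOp (i : Fin m) (u v : SchwartzSpace m) :
    inner ℂ (toL2 m u) (toL2 m (partialOp m i v)) =
      -inner ℂ (toL2 m (partialOp m i u)) (toL2 m v) := by
  rw [inner_toL2, inner_toL2]
  have h := SchwartzMap.integral_bilinear_lineDerivOp_right_eq_neg_left u v
    ((ContinuousLinearMap.mul ℝ ℂ).comp (Complex.conjCLE : ℂ →L[ℝ] ℂ))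
    (EuclideanSpace.single i (1 : ℝ)) (μ := volume)
  simpa [partialOp, mul_comm] using h

/-- The ladder operators `x_i ± ∂_i`. -/
def ladderOp (m : ℕ) (s : ℤˣ) (i : Fin m) : SchwartzOp m :=
  coordOp m i + ((s : ℤ) : ℂ) • partialOp m i

theorem units_cast_mul_self (s : ℤˣ) : ((s : ℤ) : ℂ) * (s : ℤ) = 1 := by
  rcases Int.units_eq_one_or s with rfl | rfl <;> simp

theorem inner_toL2_ladderOp (s : ℤˣ) (i : Fin m) (u v : SchwartzSpace m) :
    inner ℂ (toL2 m u) (toL2 m (ladderOp m (-s) i v)) =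
      inner ℂ (toL2 m (ladderOp m s i u)) (toL2 m v) := by
  simp only [ladderOp, add_apply, smul_apply, map_add, map_smul, inner_add_left, inner_add_right,
    inner_smul_left, inner_smul_right, inner_toL2_coordOp, inner_toL2_partialOp]
  simp

theorem hOp_eq_sum : hOp m = (1 / 2 : ℂ) •
    ∑ i, (coordOp m i * coordOp m i - partialOp m i * partialOp m i) := by
  rw [hOp, lapOp_eq_sum, normSqOp_eq_sum, Finset.sum_sub_distrib]
  module

theorem sum_ladderOp_mul_ladderOp (s : ℤˣ) :
    ∑ i, ladderOp m (-s) i * ladderOp m s i = (2 : ℂ) • hOp m - ((s : ℤ) * m : ℂ) • 1 := by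
  have h (i : Fin m) : ladderOp m (-s) i * ladderOp m s i =
      (coordOp m i * coordOp m i - partialOp m i * partialOp m i) - ((s : ℤ) : ℂ) • 1 := by
    have hc := partialOp_mul_coordOp i i
    rw [if_pos rfl] at hc
    have hs := units_cast_mul_self s
    simp only [ladderOp, add_mul, mul_add, Units.val_neg, Int.cast_neg, smul_mul_assoc,
      mul_smul_comm, hc]
    match_scalars <;> first | ring1 | linear_combination -hs
  simp only [h]
  rw [Finset.sum_sub_distrib, hOp_eq_sum, smul_smul]
  simp only [Finset.sum_const, Finset.card_univ, Fintype.card_fin, ← Nat.cast_smul_eq_nsmul ℂ]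
  module

theorem hOp_mul_ladderOp (s : ℤˣ) (i : Fin m) :
    hOp m * ladderOp m s i = ladderOp m s i * (hOp m - ((s : ℤ) : ℂ) • 1) := by
  have hx : hOp m * coordOp m i = coordOp m i * hOp m - partialOp m i := by
    have h (k : Fin m) : (coordOp m k * coordOp m k - partialOp m k * partialOp m k) * coordOp m i
        = coordOp m i * (coordOp m k * coordOp m k - partialOp m k * partialOp m k)
          - if k = i then (2 : ℂ) • partialOp m i else 0 := by
      rw [sub_mul, mul_sub, mul_assoc (partialOp m k), partialOp_mul_coordOp, mul_add, ← mul_assoc,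
        partialOp_mul_coordOp, mul_assoc (coordOp m k), coordOp_mul_coordOp k i, ← mul_assoc,
        coordOp_mul_coordOp k i]
      split_ifs with hk
      · subst hk
        simp only [add_mul, one_mul, mul_one, mul_assoc, two_smul]
        abel
      · simp [mul_assoc]
    rw [hOp_eq_sum, smul_mul_assoc, Finset.sum_mul, mul_smul_comm, Finset.mul_sum]
    simp only [h, Finset.sum_sub_distrib, Finset.sum_ite_eq', Finset.mem_univ, if_true]
    module
  have hd : hOp m * partialOp m i = partialOp m i * hOp m - coordOp m i := by
    have h (k : Fin m) : (coordOp m k * coordOp m k - partialOp m k * partialOp m k) * partialOp m i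
        = partialOp m i * (coordOp m k * coordOp m k - partialOp m k * partialOp m k)
          - if k = i then (2 : ℂ) • coordOp m i else 0 := by
      rw [sub_mul, mul_sub, ← mul_assoc (partialOp m i) (coordOp m k), partialOp_mul_coordOp,
        add_mul, mul_assoc (coordOp m k) (partialOp m i), partialOp_mul_coordOp,
        mul_assoc (partialOp m k), partialOp_mul_partialOp k i, ← mul_assoc (partialOp m k),
        partialOp_mul_partialOp k i]
      rcases eq_or_ne i k with rfl | hk
      · simp only [if_true, mul_add, one_mul, mul_one, mul_assoc, two_smul]
        abel
      · simp [mul_assoc, hk, hk.symm]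
    rw [hOp_eq_sum, smul_mul_assoc, Finset.sum_mul, mul_smul_comm, Finset.mul_sum]
    simp only [h, Finset.sum_sub_distrib, Finset.sum_ite_eq', Finset.mem_univ, if_true]
    module
  have hs := units_cast_mul_self s
  rw [ladderOp, mul_add, mul_smul_comm, hx, hd, add_mul, mul_sub, smul_mul_assoc, mul_sub,
    mul_smul_comm, mul_smul_comm, mul_one, mul_one, smul_sub, smul_sub, smul_smul, hs, one_smul]
  abel

/-- The adjoint of x_i + s∂_i is x_i - s∂_i, and the sum of the products is 2h - sm. -/
theorem sum_norm_sq_ladderOp (s : ℤˣ) (u : SchwartzSpace m) :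
    ∑ i, ‖toL2 m (ladderOp m s i u)‖ ^ 2 =
      2 * (inner ℂ (toL2 m u) (toL2 m (hOp m u))).re - (s : ℤ) * m * ‖toL2 m u‖ ^ 2 := by
  have h : ∑ i, inner ℂ (toL2 m (ladderOp m s i u)) (toL2 m (ladderOp m s i u)) =
      inner ℂ (toL2 m u) (toL2 m (((2 : ℂ) • hOp m - ((s : ℤ) * m : ℂ) • 1) u)) := by
    rw [← sum_ladderOp_mul_ladderOp, sum_apply, map_sum, inner_sum]
    exact Finset.sum_congr rfl fun i _ => (inner_toL2_ladderOp s i _ _).symm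
  have h2 := congrArg Complex.re h
  simp only [inner_self_eq_norm_sq_to_K, sub_apply, smul_apply, one_apply_eq_self, map_sub, map_smul,
    inner_sub_right, inner_smul_right] at h2
  simpa [← Complex.ofReal_pow] using h2

/-- The spectral gap: positivity of the sum for s = 1 gives m‖u‖² ≤ 2⟨u, hu⟩, and Cauchy–Schwarz
finishes. -/
theorem norm_toL2_le_hOp (hm : 0 < m) (u : SchwartzSpace m) :
    ‖toL2 m u‖ ≤ 2 * ‖toL2 m (hOp m u)‖ := by
  have h := sum_norm_sq_ladderOp 1 u
  have h0 : 0 ≤ ∑ i, ‖toL2 m (ladderOp m 1 i u)‖ ^ 2 := by positivity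
  have h1 : (inner ℂ (toL2 m u) (toL2 m (hOp m u))).re ≤ ‖toL2 m u‖ * ‖toL2 m (hOp m u)‖ :=
    (Complex.re_le_norm _).trans (norm_inner_le_norm _ _)
  have hm' : (1 : ℝ) ≤ m := by exact_mod_cast hm
  rw [h] at h0
  simp only [Units.val_one, Int.cast_one, one_mul] at h0
  have h2 : ‖toL2 m u‖ ^ 2 ≤ m * ‖toL2 m u‖ ^ 2 := le_mul_of_one_le_left (by positivity) hm'
  by_contra! hc
  have hpos : 0 < ‖toL2 m u‖ := lt_of_le_of_lt (by positivity) hc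
  nlinarith

theorem norm_toL2_ladderOp_le_hOp (hm : 0 < m) (s : ℤˣ) (i : Fin m) (u : SchwartzSpace m) :
    ‖toL2 m (ladderOp m s i u)‖ ≤ 3 * ‖toL2 m (hOp m u)‖ := by
  have h := sum_norm_sq_ladderOp s u
  have h' := sum_norm_sq_ladderOp 1 u
  have h0 : 0 ≤ ∑ i, ‖toL2 m (ladderOp m 1 i u)‖ ^ 2 := by positivity
  have h1 : (inner ℂ (toL2 m u) (toL2 m (hOp m u))).re ≤ ‖toL2 m u‖ * ‖toL2 m (hOp m u)‖ :=
    (Complex.re_le_norm _).trans (norm_inner_le_norm _ _)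
  have h2 := norm_toL2_le_hOp hm u
  have h3 : ‖toL2 m (ladderOp m s i u)‖ ^ 2 ≤ ∑ i, ‖toL2 m (ladderOp m s i u)‖ ^ 2 :=
    Finset.single_le_sum (f := fun i => ‖toL2 m (ladderOp m s i u)‖ ^ 2)
      (fun i _ => by positivity) (Finset.mem_univ i)
  have h4 : -(((s : ℤ) : ℝ) * m * ‖toL2 m u‖ ^ 2) ≤ m * ‖toL2 m u‖ ^ 2 := by
    rcases Int.units_eq_one_or s with rfl | rfl
    · simp; positivity
    · simp
  have h5 : ‖toL2 m u‖ * ‖toL2 m (hOp m u)‖ ≤ 2 * ‖toL2 m (hOp m u)‖ ^ 2 := by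
    nlinarith [norm_nonneg (toL2 m (hOp m u))]
  rw [h'] at h0
  simp only [Units.val_one, Int.cast_one, one_mul] at h0
  refine abs_le_of_sq_le_sq' ?_ (by positivity) |>.2
  -- The square is at most 2⟨u, hu⟩ + m‖u‖² ≤ 4⟨u, hu⟩ ≤ 8‖hu‖², which is below (3‖hu‖)².
  nlinarith

/-- A function on `𝓢(ℝ^m)` bounded by the `L²` norm of some `h^n u`. -/
def HermiteBounded (q : SchwartzSpace m → ℝ) : Prop :=
  ∃ (n : ℕ) (C : ℝ), 0 ≤ C ∧ ∀ u, q u ≤ C * ‖toL2 m ((hOp m ^ n) u)‖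

theorem HermiteBounded.mono {p q : SchwartzSpace m → ℝ} (hq : HermiteBounded q)
    (h : ∀ u, p u ≤ q u) : HermiteBounded p := by
  obtain ⟨n, C, hC, hb⟩ := hq
  exact ⟨n, C, hC, fun u => (h u).trans (hb u)⟩

theorem HermiteBounded.const_mul {q : SchwartzSpace m → ℝ} (hq : HermiteBounded q) {c : ℝ}
    (hc : 0 ≤ c) : HermiteBounded fun u => c * q u := by
  obtain ⟨n, C, hC, hb⟩ := hq
  exact ⟨n, c * C, by positivity, fun u => by rw [mul_assoc]; exact mul_le_mul_of_nonneg_left (hb u) hc⟩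

theorem norm_toL2_hOp_pow_le (hm : 0 < m) (n k : ℕ) (u : SchwartzSpace m) :
    ‖toL2 m ((hOp m ^ n) u)‖ ≤ 2 ^ k * ‖toL2 m ((hOp m ^ (n + k)) u)‖ := by
  induction k with
  | zero => simp
  | succ k ih =>
    refine ih.trans ?_
    rw [← add_assoc, pow_succ' (hOp m), mul_apply_eq_comp, pow_succ (2 : ℝ), mul_assoc]
    gcongr
    exact norm_toL2_le_hOp hm _

theorem HermiteBounded.add (hm : 0 < m) {p q : SchwartzSpace m → ℝ} (hp : HermiteBounded p)
    (hq : HermiteBounded q) : HermiteBounded fun u => p u + q u := by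
  obtain ⟨n, C, hC, hb⟩ := hp
  obtain ⟨k, D, hD, hb'⟩ := hq
  refine ⟨n + k, C * 2 ^ k + D * 2 ^ n, by positivity, fun u => ?_⟩
  rw [add_mul, mul_assoc, mul_assoc]
  refine add_le_add ((hb u).trans ?_) ((hb' u).trans ?_)
  · gcongr
    exact norm_toL2_hOp_pow_le hm n k u
  · gcongr
    rw [add_comm n k]
    exact norm_toL2_hOp_pow_le hm k n u

theorem HermiteBounded.sum (hm : 0 < m) {ι : Type*} (s : Finset ι) {q : ι → SchwartzSpace m → ℝ}
    (hq : ∀ i ∈ s, HermiteBounded (q i)) : HermiteBounded fun u => ∑ i ∈ s, q i u := by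
  classical
  induction s using Finset.induction_on with
  | empty => exact ⟨0, 0, le_rfl, fun u => by simp⟩
  | insert a s ha ih =>
    simp only [Finset.sum_insert ha]
    exact (hq a (Finset.mem_insert_self a s)).add hm
      (ih fun i hi => hq i (Finset.mem_insert_of_mem hi))

/-- The algebra of differential operators with polynomial coefficients. -/
def weylAlgebra (m : ℕ) : Subalgebra ℂ (SchwartzOp m) :=
  Algebra.adjoin ℂ (Set.range fun p : ℤˣ × Fin m => ladderOp m p.1 p.2)

theorem ladderOp_mem_weylAlgebra (s : ℤˣ) (i : Fin m) : ladderOp m s i ∈ weylAlgebra m :=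
  Algebra.subset_adjoin ⟨(s, i), rfl⟩

theorem coordOp_mem_weylAlgebra (i : Fin m) : coordOp m i ∈ weylAlgebra m := by
  have h : coordOp m i = (1 / 2 : ℂ) • (ladderOp m 1 i + ladderOp m (-1) i) := by
    simp only [ladderOp, Units.val_neg, Units.val_one, Int.cast_neg, Int.cast_one]
    module
  rw [h]
  exact Subalgebra.smul_mem _ (add_mem (ladderOp_mem_weylAlgebra _ _)
    (ladderOp_mem_weylAlgebra _ _)) _

theorem partialOp_mem_weylAlgebra (i : Fin m) : partialOp m i ∈ weylAlgebra m := by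
  have h : partialOp m i = (1 / 2 : ℂ) • (ladderOp m 1 i - ladderOp m (-1) i) := by
    simp only [ladderOp, Units.val_neg, Units.val_one, Int.cast_neg, Int.cast_one]
    module
  rw [h]
  exact Subalgebra.smul_mem _ (sub_mem (ladderOp_mem_weylAlgebra _ _)
    (ladderOp_mem_weylAlgebra _ _)) _

theorem lapOp_mem_weylAlgebra : lapOp m ∈ weylAlgebra m := by
  rw [lapOp_eq_sum]
  exact sum_mem fun i _ => mul_mem (partialOp_mem_weylAlgebra i) (partialOp_mem_weylAlgebra i)

theorem normSqOp_mem_weylAlgebra : normSqOp m ∈ weylAlgebra m := by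
  rw [normSqOp_eq_sum]
  exact sum_mem fun i _ => mul_mem (coordOp_mem_weylAlgebra i) (coordOp_mem_weylAlgebra i)

/-- Each letter of a word in ladder operators costs one power of h: the new letter is bounded by
3‖hAu‖, and h moves through A at the price of a scalar c. The commutation rule is carried along in
the induction for this purpose. -/
theorem hermiteBounded_norm_toL2_of_mem_closure (hm : 0 < m) {A : SchwartzOp m}
    (hA : A ∈ Submonoid.closure (Set.range fun p : ℤˣ × Fin m => ladderOp m p.1 p.2)) :
    (∃ c : ℂ, hOp m * A = A * (hOp m + c • 1)) ∧ HermiteBounded fun u => ‖toL2 m (A u)‖ := by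
  induction hA using Submonoid.closure_induction_left with
  | one => exact ⟨⟨0, by simp⟩, 0, 1, zero_le_one, fun u => by simp⟩
  | mul_left x hx A _ ih =>
    obtain ⟨⟨s, i⟩, rfl⟩ := hx
    obtain ⟨⟨c, hc⟩, n, C, hC, hb⟩ := ih
    refine ⟨⟨c - ((s : ℤ) : ℂ), ?_⟩, ?_⟩
    · rw [← mul_assoc, hOp_mul_ladderOp, mul_assoc, sub_mul, hc, smul_mul_assoc, one_mul,
        mul_assoc]
      congr 1
      simp only [mul_add, mul_smul_comm, mul_one]
      module
    · have h1 : HermiteBounded fun u => 3 * (‖toL2 m (A (hOp m u))‖ + ‖c‖ * ‖toL2 m (A u)‖) := by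
        refine HermiteBounded.const_mul (HermiteBounded.add hm ?_ ?_) (by norm_num)
        · exact ⟨n + 1, C, hC, fun u => by simpa only [pow_succ, mul_apply_eq_comp] using hb (hOp m u)⟩
        · exact HermiteBounded.const_mul ⟨n, C, hC, hb⟩ (norm_nonneg c)
      refine h1.mono fun u => ?_
      refine (norm_toL2_ladderOp_le_hOp hm s i (A u)).trans ?_
      gcongr
      rw [← mul_apply_eq_comp, hc, mul_apply_eq_comp, add_apply, smul_apply, one_apply_eq_self,
        map_add, map_smul, map_add, map_smul]
      exact (norm_add_le _ _).trans_eq (by rw [norm_smul])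

theorem hermiteBounded_norm_toL2 (hm : 0 < m) {A : SchwartzOp m} (hA : A ∈ weylAlgebra m) :
    HermiteBounded fun u => ‖toL2 m (A u)‖ := by
  rw [weylAlgebra, ← Subalgebra.mem_toSubmodule, Algebra.adjoin_eq_span] at hA
  induction hA using Submodule.span_induction with
  | mem A hA => exact (hermiteBounded_norm_toL2_of_mem_closure hm hA).2
  | zero => exact ⟨0, 0, le_rfl, fun u => by simp⟩
  | add A B _ _ hA hB =>
    exact (hA.add hm hB).mono fun u => by
      rw [add_apply, map_add]; exact norm_add_le _ _
  | smul c A _ hA =>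
    exact (hA.const_mul (norm_nonneg c)).mono fun u => by
      rw [smul_apply, map_smul, norm_smul]

end SquareIntegrable

/-! ### Schwartz seminorms controlled by L² norms of h^n u. -/

noncomputable section Seminorms

open MeasureTheory FourierTransform

variable {m : ℕ}

theorem norm_sq_toL2 (u : SchwartzSpace m) : ‖toL2 m u‖ ^ 2 = ∫ x, ‖u x‖ ^ 2 := by
  have h := inner_toL2 u u
  rw [inner_self_eq_norm_sq_to_K] at h
  simp only [inner_self_eq_norm_sq_to_K, Complex.coe_algebraMap, ← Complex.ofReal_pow] at h
  rw [integral_complex_ofReal] at h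
  exact_mod_cast h

theorem norm_toL2_fourier (u : SchwartzSpace m) : ‖toL2 m (𝓕 u)‖ = ‖toL2 m u‖ :=
  SchwartzMap.norm_fourier_toL2_eq u

/-- Cauchy–Schwarz with the weight `(1 + |x|²)^m`. -/
theorem exists_integral_norm_le (hm : 0 < m) : ∃ C : ℝ, 0 ≤ C ∧ ∀ u : SchwartzSpace m,
    ∫ x, ‖u x‖ ≤ C * ‖toL2 m (((1 + normSqOp m) ^ m) u)‖ := by
  have happ (n : ℕ) (u : SchwartzSpace m) (x : EuclideanSpace ℝ (Fin m)) :
      ((1 + normSqOp m) ^ n) u x = (((1 + ‖x‖ ^ 2) ^ n : ℝ) : ℂ) * u x := by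
    induction n generalizing u with
    | zero => simp
    | succ n ih =>
      rw [pow_succ, mul_apply_eq_comp, ih, add_apply, add_apply, one_apply_eq_self, normSqOp_apply]
      push_cast
      ring
  have hint : Integrable (fun x : EuclideanSpace ℝ (Fin m) => (((1 + ‖x‖ ^ 2) ^ m)⁻¹) ^ 2) := by
    have h := integrable_rpow_neg_one_add_norm_sq (E := EuclideanSpace ℝ (Fin m))
      (μ := volume) (r := 4 * m) (by
        rw [finrank_euclideanSpace_fin]
        have : (0 : ℝ) < m := by exact_mod_cast hm
        linarith)
    refine h.congr (Filter.Eventually.of_forall fun x => ?_)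
    have h0 : (0 : ℝ) ≤ 1 + ‖x‖ ^ 2 := by positivity
    simp only
    rw [show -(4 * m : ℝ) / 2 = -((m * 2 : ℕ) : ℝ) by push_cast; ring, Real.rpow_neg h0,
      Real.rpow_natCast, pow_mul, inv_pow]
  refine ⟨(∫ x : EuclideanSpace ℝ (Fin m), (((1 + ‖x‖ ^ 2) ^ m)⁻¹) ^ 2) ^ (1 / 2 : ℝ),
    by positivity, fun u => ?_⟩
  set v := ((1 + normSqOp m) ^ m) u with hv
  have hcont : Continuous fun x : EuclideanSpace ℝ (Fin m) => ((1 + ‖x‖ ^ 2) ^ m)⁻¹ :=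
    Continuous.inv₀ (by fun_prop) fun x => by positivity
  have h := integral_mul_le_Lp_mul_Lq_of_nonneg (μ := (volume : Measure (EuclideanSpace ℝ (Fin m))))
    Real.HolderConjugate.two_two
    (f := fun x => ((1 + ‖x‖ ^ 2) ^ m)⁻¹) (g := fun x => ‖v x‖)
    (Filter.Eventually.of_forall fun x => by positivity)
    (Filter.Eventually.of_forall fun x => by positivity)
    (by
      rw [show ENNReal.ofReal 2 = 2 by norm_num]
      exact (memLp_two_iff_integrable_sq hcont.aestronglyMeasurable).2 hint)
    (by
      rw [show ENNReal.ofReal 2 = 2 by norm_num]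
      exact (v.memLp 2 volume).norm)
  simp only [Real.rpow_two] at h
  rw [← norm_sq_toL2, ← Real.sqrt_eq_rpow (‖toL2 m v‖ ^ 2), Real.sqrt_sq (norm_nonneg _)] at h
  refine le_trans (le_of_eq ?_) h
  congr 1
  ext x
  rw [hv, happ, norm_mul, Complex.norm_real, Real.norm_of_nonneg (by positivity), ← mul_assoc,
    inv_mul_cancel₀ (by positivity), one_mul]

theorem normSqOp_fourier (u : SchwartzSpace m) :
    normSqOp m (𝓕 u) = 𝓕 ((-(1 / (4 * Real.pi ^ 2)) : ℂ) • lapOp m u) := by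
  have hpi : (Real.pi : ℂ) ≠ 0 := by exact_mod_cast Real.pi_ne_zero
  have h (i : Fin m) : 𝓕 ((partialOp m i * partialOp m i) u) =
      (-(4 * Real.pi ^ 2) : ℂ) • (coordOp m i * coordOp m i) (𝓕 u) := by
    rw [mul_apply_eq_comp, mul_apply_eq_comp, fourier_partialOp, fourier_partialOp, map_smul,
      smul_smul]
    congr 1
    linear_combination (4 * Real.pi ^ 2 : ℂ) * Complex.I_sq
  rw [FourierTransform.fourier_smul, lapOp_eq_sum, normSqOp_eq_sum, sum_apply, sum_apply,
    FourierTransform.fourier_sum, Finset.smul_sum]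
  refine Finset.sum_congr rfl fun i _ => ?_
  rw [h, smul_smul]
  have : (-(1 / (4 * Real.pi ^ 2)) : ℂ) * -(4 * Real.pi ^ 2) = 1 := by field_simp
  rw [this, one_smul]

/-- A Sobolev estimate: the supremum of u is at most the L¹ norm of its Fourier transform, hence at
most a weighted L² norm of it. By Plancherel the weight becomes a power of 1 - Δ/(4π²) acting on u.
-/
theorem hermiteBounded_norm_apply (hm : 0 < m) :
    ∃ q : SchwartzSpace m → ℝ, (∀ A ∈ weylAlgebra m, HermiteBounded fun u => q (A u)) ∧
      ∀ u x, ‖u x‖ ≤ q u := by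
  obtain ⟨C, hC, h⟩ := exists_integral_norm_le hm
  set L : SchwartzOp m := 1 + (-(1 / (4 * Real.pi ^ 2)) : ℂ) • lapOp m with hL
  have hLmem : L ∈ weylAlgebra m :=
    add_mem (one_mem _) (Subalgebra.smul_mem _ lapOp_mem_weylAlgebra _)
  have hLF (n : ℕ) (u : SchwartzSpace m) : ((1 + normSqOp m) ^ n) (𝓕 u) = 𝓕 ((L ^ n) u) := by
    induction n generalizing u with
    | zero => simp
    | succ n ih =>
      rw [pow_succ, pow_succ, mul_apply_eq_comp, mul_apply_eq_comp, ← ih, add_apply,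
        one_apply_eq_self, normSqOp_fourier, ← FourierTransform.fourier_add, hL, add_apply,
        one_apply_eq_self, smul_apply]
  refine ⟨fun u => C * ‖toL2 m ((L ^ m) u)‖, fun A hA => ?_, fun u x => ?_⟩
  · exact (hermiteBounded_norm_toL2 hm (mul_mem (pow_mem hLmem m) hA)).const_mul hC
  · simp only
    rw [← norm_toL2_fourier, ← hLF]
    refine le_trans ?_ (h (𝓕 u))
    have h1 : u x = 𝓕 (𝓕 u) (-x) := by
      have h2 : 𝓕⁻ (𝓕 u) = u := FourierTransform.fourierInv_fourier_eq u
      conv_lhs => rw [← h2, SchwartzMap.fourierInv_apply_eq]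
      rfl
    rw [h1, ← SchwartzMap.norm_toLp_one]
    exact SchwartzMap.norm_fourier_apply_le_toLp_one _ _

theorem norm_iteratedFDeriv_sum_le {ι E F : Type*} [NormedAddCommGroup E] [NormedSpace ℝ E]
    [NormedAddCommGroup F] [NormedSpace ℝ F] (s : Finset ι) {f : ι → E → F} {l : ℕ}
    (hf : ∀ i ∈ s, ContDiff ℝ l (f i)) (x : E) :
    ‖iteratedFDeriv ℝ l (fun y => ∑ i ∈ s, f i y) x‖ ≤ ∑ i ∈ s, ‖iteratedFDeriv ℝ l (f i) x‖ := by
  rw [iteratedFDeriv_sum hf, Finset.sum_apply]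
  exact norm_sum_le _ _

/-- The differential of u is the sum of the ∂_i u times the coordinate forms, so one derivative can
be traded for partial derivatives. -/
theorem seminorm_succ_le (k l : ℕ) : ∃ C : Fin m → ℝ, (∀ i, 0 ≤ C i) ∧ ∀ u : SchwartzSpace m,
    SchwartzMap.seminorm ℂ k (l + 1) u ≤
      ∑ i, C i * SchwartzMap.seminorm ℂ k l (partialOp m i u) := by
  set L : Fin m → ℂ →L[ℝ] (EuclideanSpace ℝ (Fin m) →L[ℝ] ℂ) := fun i =>
    ContinuousLinearMap.smulRightL ℝ (EuclideanSpace ℝ (Fin m)) ℂ (EuclideanSpace.proj i) with hL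
  refine ⟨fun i => ‖L i‖, fun i => norm_nonneg (L i), fun u => ?_⟩
  refine SchwartzMap.seminorm_le_bound ℂ k (l + 1) u
    (Finset.sum_nonneg fun i _ => mul_nonneg (norm_nonneg (L i)) (apply_nonneg _ _)) fun x => ?_
  have hf : fderiv ℝ u = fun y => ∑ i, (L i ∘ partialOp m i u) y := by
    ext1 y
    ext v
    have hv : v = ∑ i, v i • EuclideanSpace.single i (1 : ℝ) := by
      have := (EuclideanSpace.basisFun (Fin m) ℝ).sum_repr v
      simpa using this.symm
    conv_lhs => rw [hv]
    rw [map_sum, sum_apply]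
    refine Finset.sum_congr rfl fun i _ => ?_
    simp [hL, partialOp_apply_eq_fderiv]
  rw [← norm_iteratedFDeriv_fderiv, hf]
  calc ‖x‖ ^ k * ‖iteratedFDeriv ℝ l (fun y => ∑ i, (L i ∘ partialOp m i u) y) x‖
      ≤ ‖x‖ ^ k * ∑ i, ‖L i‖ * ‖iteratedFDeriv ℝ l (partialOp m i u) x‖ := by
        gcongr
        refine (norm_iteratedFDeriv_sum_le _ (fun i _ =>
          (L i).contDiff.comp ((partialOp m i u).smooth l)) x).trans (Finset.sum_le_sum fun i _ => ?_)
        exact (L i).norm_iteratedFDeriv_comp_left ((partialOp m i u).smooth l).contDiffAt le_rfl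
    _ = ∑ i, ‖L i‖ * (‖x‖ ^ k * ‖iteratedFDeriv ℝ l (partialOp m i u) x‖) := by
        rw [Finset.mul_sum]
        exact Finset.sum_congr rfl fun i _ => by ring
    _ ≤ _ := Finset.sum_le_sum fun i _ =>
        mul_le_mul_of_nonneg_left (SchwartzMap.le_seminorm ℂ k l _ x) (norm_nonneg (L i))

theorem normSqOp_pow_apply (k : ℕ) (u : SchwartzSpace m) (x : EuclideanSpace ℝ (Fin m)) :
    (normSqOp m ^ k) u x = (((‖x‖ ^ 2) ^ k : ℝ) : ℂ) * u x := by
  induction k generalizing u with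
  | zero => simp
  | succ k ih =>
    rw [pow_succ, mul_apply_eq_comp, ih, normSqOp_apply]
    push_cast
    ring

/-- The Schwartz seminorms are bounded by the `L²` norms of `h^n u`. -/
theorem hermiteBounded_seminorm (hm : 0 < m) (k l : ℕ) {A : SchwartzOp m}
    (hA : A ∈ weylAlgebra m) :
    HermiteBounded fun u => SchwartzMap.seminorm ℂ k l (A u) := by
  induction l generalizing A with
  | zero =>
    obtain ⟨q, hq, hb⟩ := hermiteBounded_norm_apply hm
    refine ((hq A hA).add hm (hq _ (mul_mem (pow_mem normSqOp_mem_weylAlgebra k) hA))).mono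
      fun u => ?_
    have hq0 (u : SchwartzSpace m) : 0 ≤ q u := (norm_nonneg _).trans (hb u 0)
    refine SchwartzMap.seminorm_le_bound ℂ k 0 _ (add_nonneg (hq0 _) (hq0 _)) fun x => ?_
    rw [norm_iteratedFDeriv_zero]
    have h1 := hb (A u) x
    have h2 := hb ((normSqOp m ^ k * A) u) x
    rw [mul_apply_eq_comp, normSqOp_pow_apply, norm_mul, Complex.norm_real,
      Real.norm_of_nonneg (by positivity), ← mul_apply_eq_comp] at h2
    refine le_trans ?_ (add_le_add h1 h2)
    -- Odd powers of |x| are not polynomial weights, so they are dominated by even ones.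
    have h3 : ‖x‖ ^ k ≤ 1 + (‖x‖ ^ 2) ^ k := by
      rw [← pow_mul, mul_comm 2 k, pow_mul]
      nlinarith [sq_nonneg (‖x‖ ^ k - 1), sq_nonneg (‖x‖ ^ k)]
    calc ‖x‖ ^ k * ‖A u x‖ ≤ (1 + (‖x‖ ^ 2) ^ k) * ‖A u x‖ := by gcongr
      _ = _ := by ring
  | succ l ih =>
    obtain ⟨C, hC, h⟩ := seminorm_succ_le (m := m) k l
    refine (HermiteBounded.sum hm Finset.univ
      (q := fun i u => C i * SchwartzMap.seminorm ℂ k l ((partialOp m i * A) u)) fun i _ =>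
      (ih (mul_mem (partialOp_mem_weylAlgebra i) hA)).const_mul (hC i)).mono fun u => h (A u)

end Seminorms

/-! ### Density of the Hermite functions, first in L², then in the Schwartz space. -/

noncomputable section Density

open MeasureTheory FourierTransform MvPolynomial

variable {m : ℕ}

/-- This supplies the dominating function for expanding the Fourier kernel under the integral.
Completing the square gives 2c|x| - |x|² ≤ 2c² - |x|²/2. -/
theorem memLp_exp_mul_norm_mul_gaussian (c : ℝ) :
    MemLp (fun x : EuclideanSpace ℝ (Fin m) => Real.exp (c * ‖x‖) * Real.exp (-‖x‖ ^ 2 / 2)) 2 := by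
  rw [memLp_two_iff_integrable_sq (Continuous.aestronglyMeasurable (by fun_prop))]
  have h : Integrable fun x : EuclideanSpace ℝ (Fin m) =>
      Real.exp (2 * c ^ 2) * ‖gaussian m x‖ := (gaussian m).integrable.norm.const_mul _
  refine h.mono' (Continuous.aestronglyMeasurable (by fun_prop))
    (Filter.Eventually.of_forall fun x => ?_)
  rw [gaussian_apply, Complex.norm_real, Real.norm_of_nonneg (by positivity),
    Real.norm_of_nonneg (Real.exp_pos _).le, ← Real.exp_add, ← Real.exp_add, ← Real.exp_nat_mul]
  gcongr
  push_cast
  nlinarith [sq_nonneg (2 * c - ‖x‖)]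

theorem integral_inner_pow_mul_gaussian_mul_eq_zero
    {w : Lp ℂ 2 (volume : Measure (EuclideanSpace ℝ (Fin m)))}
    (hw : ∀ p, inner ℂ (toL2 m (gaussPoly m p)) w = 0) (ξ : EuclideanSpace ℝ (Fin m)) (n : ℕ) :
    ∫ x, ((inner ℝ x ξ : ℝ) : ℂ) ^ n * ((Real.exp (-‖x‖ ^ 2 / 2) : ℂ) * w x) = 0 := by
  rw [← hw ((∑ i, C (ξ i : ℂ) * X i) ^ n), L2.inner_def]
  refine integral_congr_ae ?_
  filter_upwards [(gaussPoly m ((∑ i, C (ξ i : ℂ) * X i) ^ n)).coeFn_toLp 2 volume] with x hx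
  have hx' : (toL2 m (gaussPoly m ((∑ i, C (ξ i : ℂ) * X i) ^ n))) x =
    gaussPoly m ((∑ i, C (ξ i : ℂ) * X i) ^ n) x := hx
  have h1 : eval (fun i => ((x i : ℝ) : ℂ)) ((∑ i, C (ξ i : ℂ) * X i) ^ n) =
      (((inner ℝ x ξ) ^ n : ℝ) : ℂ) := by
    simp [PiLp.inner_apply]
  rw [hx', gaussPoly_apply, h1, ← Complex.ofReal_mul, RCLike.inner_apply, Complex.conj_ofReal]
  push_cast
  ring

/-- Expand the exponential: every term is a multiple of a moment against ⟨x, ξ⟩^n, which vanishes by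
orthogonality. -/
theorem fourier_gaussian_mul_eq_zero
    {w : Lp ℂ 2 (volume : Measure (EuclideanSpace ℝ (Fin m)))}
    (hw : ∀ p, inner ℂ (toL2 m (gaussPoly m p)) w = 0) (ξ : EuclideanSpace ℝ (Fin m)) :
    𝓕 (fun x => (Real.exp (-‖x‖ ^ 2 / 2) : ℂ) * w x) ξ = 0 := by
  rw [Real.fourier_eq']
  set c := 2 * Real.pi * ‖ξ‖ with hc
  have hbound (x : EuclideanSpace ℝ (Fin m)) :
      HasSum (fun n : ℕ => (c * ‖x‖) ^ n / n ! * (Real.exp (-‖x‖ ^ 2 / 2) * ‖w x‖))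
        (Real.exp (c * ‖x‖) * (Real.exp (-‖x‖ ^ 2 / 2) * ‖w x‖)) := by
    refine HasSum.mul_right _ ?_
    rw [Real.exp_eq_exp_ℝ]
    exact NormedSpace.expSeries_div_hasSum_exp _
  have h := hasSum_integral_of_dominated_convergence
    (μ := (volume : Measure (EuclideanSpace ℝ (Fin m))))
    (F := fun (n : ℕ) x => (((-2 * Real.pi * inner ℝ x ξ : ℝ) : ℂ) * Complex.I) ^ n / n ! *
      ((Real.exp (-‖x‖ ^ 2 / 2) : ℂ) * w x))
    (f := fun x => Complex.exp (((-2 * Real.pi * inner ℝ x ξ : ℝ) : ℂ) * Complex.I) •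
      ((Real.exp (-‖x‖ ^ 2 / 2) : ℂ) * w x))
    (fun n x => (c * ‖x‖) ^ n / n ! * (Real.exp (-‖x‖ ^ 2 / 2) * ‖w x‖))
    (fun n => by
      refine AEStronglyMeasurable.mul (Continuous.aestronglyMeasurable (by fun_prop)) ?_
      exact AEStronglyMeasurable.mul (Continuous.aestronglyMeasurable (by fun_prop))
        (Lp.aestronglyMeasurable w))
    (fun n => Filter.Eventually.of_forall fun x => by
      rw [norm_mul, norm_mul, norm_div, norm_pow, norm_mul, Complex.norm_I, mul_one,
        Complex.norm_real, Complex.norm_real, Complex.norm_natCast,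
        Real.norm_of_nonneg (Real.exp_pos _).le]
      gcongr
      rw [norm_mul, norm_mul, hc]
      simp only [norm_neg, RCLike.norm_ofNat, Real.norm_of_nonneg Real.pi_pos.le]
      rw [mul_assoc (2 * Real.pi)]
      gcongr
      rw [mul_comm]
      exact norm_inner_le_norm x ξ)
    (Filter.Eventually.of_forall fun x => (hbound x).summable)
    (by
      simp only [fun x => (hbound x).tsum_eq]
      have := (memLp_exp_mul_norm_mul_gaussian (m := m) c).integrable_mul (Lp.memLp w).norm
      refine this.congr (Filter.Eventually.of_forall fun x => ?_)
      simp [mul_assoc])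
    (Filter.Eventually.of_forall fun x => by
      rw [smul_eq_mul]
      refine HasSum.mul_right _ ?_
      rw [Complex.exp_eq_exp_ℂ]
      exact NormedSpace.expSeries_div_hasSum_exp _)
  have h0 (n : ℕ) : ∫ x, (((-2 * Real.pi * inner ℝ x ξ : ℝ) : ℂ) * Complex.I) ^ n / n ! *
      ((Real.exp (-‖x‖ ^ 2 / 2) : ℂ) * w x) = 0 := by
    rw [← mul_zero ((-2 * Real.pi * Complex.I) ^ n / n !),
      ← integral_inner_pow_mul_gaussian_mul_eq_zero hw ξ n, ← integral_const_mul]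
    congr 1
    ext x
    push_cast
    ring
  simp only [h0] at h
  exact h.unique hasSum_zero

/-- The function f = e^(-|x|²/2) w is integrable with zero Fourier transform. Writing a test
function v as 𝓕(𝓕⁻¹v) and moving 𝓕 onto f gives ∫ f v = 0, so f and hence w vanish almost
everywhere. -/
theorem eq_zero_of_inner_gaussPoly_eq_zero
    {w : Lp ℂ 2 (volume : Measure (EuclideanSpace ℝ (Fin m)))}
    (hw : ∀ p, inner ℂ (toL2 m (gaussPoly m p)) w = 0) : w = 0 := by
  set f : EuclideanSpace ℝ (Fin m) → ℂ := fun x => (Real.exp (-‖x‖ ^ 2 / 2) : ℂ) * w x with hf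
  have hint : Integrable f := by
    have := ((gaussian m).memLp 2 volume).integrable_mul (Lp.memLp w)
    refine this.congr (Filter.Eventually.of_forall fun x => ?_)
    rw [Pi.mul_apply, gaussian_apply]
  have hzero : ∀ᵐ x, f x = 0 := by
    refine ae_eq_zero_of_integral_contDiff_smul_eq_zero hint.locallyIntegrable fun g hg hgs => ?_
    have hg' : ContDiff ℝ ((⊤ : ℕ∞) : WithTop ℕ∞) fun x => (g x : ℂ) :=
      Complex.ofRealCLM.contDiff.comp hg
    have hgs' : HasCompactSupport fun x => (g x : ℂ) :=
      hgs.comp_left (g := Complex.ofReal) Complex.ofReal_zero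
    set v : SchwartzSpace m := hgs'.toSchwartzMap hg'
    have h := VectorFourier.integral_fourierIntegral_smul_eq_flip (L := innerₗ _)
      Real.continuous_fourierChar continuous_inner hint (𝓕⁻ v).integrable (ν := volume)
    have h1 : ∀ ξ, VectorFourier.fourierIntegral Real.fourierChar volume (innerₗ _) f ξ = 0 :=
      fourier_gaussian_mul_eq_zero hw
    have h2 : ∀ x, VectorFourier.fourierIntegral Real.fourierChar volume
        (innerₗ (EuclideanSpace ℝ (Fin m))).flip (⇑(𝓕⁻ v : SchwartzSpace m)) x = v x := by
      intro x
      rw [flip_innerₗ]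
      have h3 : 𝓕 (𝓕⁻ v : SchwartzSpace m) = v := FourierTransform.fourier_fourierInv_eq v
      exact congrArg (fun u : SchwartzSpace m => u x) h3
    simp only [h1, h2, zero_smul, integral_zero] at h
    rw [h]
    congr 1
    ext x
    rw [Complex.real_smul, smul_eq_mul, mul_comm]
    rfl
  refine (Lp.eq_zero_iff_ae_eq_zero).2 ?_
  filter_upwards [hzero] with x hx
  have := Real.exp_pos (-‖x‖ ^ 2 / 2)
  simpa [hf] using hx

theorem topologicalClosure_map_toL2_range_gaussPoly :
    ((LinearMap.range (gaussPoly m)).map (toL2 m).toLinearMap).topologicalClosure = ⊤ := by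
  rw [Submodule.topologicalClosure_eq_top_iff, Submodule.eq_bot_iff]
  intro w hw
  refine eq_zero_of_inner_gaussPoly_eq_zero fun p => ?_
  exact (Submodule.mem_orthogonal _ w).1 hw _ ⟨_, ⟨p, rfl⟩, rfl⟩

/-- On the Hermite functions, which span, h has the nonzero eigenvalues m/2 + k + 2j. -/
theorem exists_hOp_pow_gaussPoly (hm : 0 < m) (n : ℕ) (p : MvPolynomial (Fin m) ℂ) :
    ∃ q, (hOp m ^ n) (gaussPoly m q) = gaussPoly m p := by
  have key : LinearMap.range (gaussPoly m) ≤
      (LinearMap.range (gaussPoly m)).map (hOp m ^ n).toLinearMap := by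
    conv_lhs => rw [← span_isHermiteFunction hm]
    rw [Submodule.span_le]
    rintro _ hv
    obtain ⟨j, k, H, hH, rfl⟩ := isHermiteFunction_iff.1 hv
    set c : ℂ := m / 2 + (k + 2 * j : ℕ) with hc
    have hc0 : c ≠ 0 := by
      have : ((m : ℝ) / 2 + (k + 2 * j : ℕ)) ≠ 0 := by positivity
      have h2 : c = ((((m : ℝ) / 2 + (k + 2 * j : ℕ)) : ℝ) : ℂ) := by rw [hc]; push_cast; rfl
      rw [h2]
      exact Complex.ofReal_ne_zero.2 this
    have hpow : (hOp m ^ n) (gaussPoly m (hermitePoly j k H)) =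
        c ^ n • gaussPoly m (hermitePoly j k H) := by
      induction n with
      | zero => simp
      | succ n ih =>
        rw [pow_succ, mul_apply_eq_comp, hOp_gaussPoly_hermitePoly hm j hH, map_smul, ih, smul_smul,
          pow_succ']
    refine ⟨(c ^ n)⁻¹ • gaussPoly m (hermitePoly j k H),
      Submodule.smul_mem _ _ ⟨_, rfl⟩, ?_⟩
    change (hOp m ^ n) _ = _
    rw [map_smul, hpow, smul_smul, inv_mul_cancel₀ (pow_ne_zero n hc0), one_smul]
  obtain ⟨_, ⟨q, rfl⟩, hq⟩ := key ⟨p, rfl⟩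
  exact ⟨q, hq⟩

/-- Polynomials times the Gaussian are dense in the Schwartz space. -/
theorem dense_range_gaussPoly (hm : 0 < m) :
    Dense (LinearMap.range (gaussPoly m) : Set (SchwartzSpace m)) := by
  intro u
  rw [mem_closure_iff_nhds]
  intro U hU
  obtain ⟨s, r, hr, hsub⟩ :=
    ((schwartz_withSeminorms ℂ (EuclideanSpace ℝ (Fin m)) ℂ).mem_nhds_iff u U).1 hU
  have hb : HermiteBounded fun v : SchwartzSpace m =>
      (s.sup (schwartzSeminormFamily ℂ (EuclideanSpace ℝ (Fin m)) ℂ)) v := by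
    refine (HermiteBounded.sum hm s fun i _ => hermiteBounded_seminorm hm i.1 i.2
      (one_mem (weylAlgebra m))).mono fun v => ?_
    refine (Seminorm.finset_sup_le_sum _ s v).trans_eq ?_
    rw [sum_apply]
    rfl
  obtain ⟨n, C, hC, hb⟩ := hb
  have hd : toL2 m ((hOp m ^ n) u) ∈
      ((LinearMap.range (gaussPoly m)).map (toL2 m).toLinearMap).topologicalClosure := by
    rw [topologicalClosure_map_toL2_range_gaussPoly]; trivial
  -- Approximate h^n u, not u, in L²; the preimage of the approximant under h^n is then close to u
  -- in the given seminorms. The denominator C + 1 allows C = 0 and keeps the bound strict.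
  obtain ⟨_, ⟨_, ⟨p, rfl⟩, rfl⟩, hp⟩ :=
    Metric.mem_closure_iff.1 hd (r / (C + 1)) (by positivity)
  obtain ⟨q, hq⟩ := exists_hOp_pow_gaussPoly hm n p
  refine ⟨gaussPoly m q, hsub ?_, ⟨q, rfl⟩⟩
  rw [Seminorm.mem_ball]
  refine (hb _).trans_lt ?_
  change dist _ (toL2 m (gaussPoly m p)) < _ at hp
  rw [map_sub, hq, map_sub, ← dist_eq_norm, dist_comm]
  calc C * dist (toL2 m ((hOp m ^ n) u)) (toL2 m (gaussPoly m p))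
      ≤ C * (r / (C + 1)) := by gcongr
    _ < r := by
      rw [mul_div_assoc', div_lt_iff₀ (by positivity)]
      nlinarith

theorem eq_of_eq_on_isHermiteFunction (hm : 0 < m) {S T : SchwartzOp m}
    (h : ∀ v, IsHermiteFunction v → S v = T v) : S = T := by
  have h1 : Set.EqOn S T (LinearMap.range (gaussPoly m)) := by
    rw [← span_isHermiteFunction hm]
    intro v hv
    exact LinearMap.eqOn_span (f := S.toLinearMap) (g := T.toLinearMap) h hv
  exact DFunLike.coe_injective
    (Continuous.ext_on (dense_range_gaussPoly hm) S.continuous T.continuous h1)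

end Density

/-! ### Evaluation of the operator series and exponentials on Hermite functions. -/

noncomputable section OperatorSeries

open MvPolynomial

variable {m : ℕ}

/-! The operators given by series are single valued. -/

theorem OpExp.unique {c : ℂ} {A : SchwartzSpace m → SchwartzSpace m → Prop}
    (hA : ∀ f g g', A f g → A f g' → g = g') {f g g' : SchwartzSpace m}
    (h : OpExp c A f g) (h' : OpExp c A f g') : g = g' := by
  obtain ⟨u, hu0, hu, hs⟩ := h
  obtain ⟨u', hu0', hu', hs'⟩ := h'
  have : u = u' := by
    funext n
    induction n with
    | zero => rw [hu0, hu0']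
    | succ n ih => exact hA _ _ _ (hu n) (ih ▸ hu' n)
  subst this
  exact hs.unique hs'

theorem CasimirF.unique {f g g' : SchwartzSpace m} (h : CasimirF m f g) (h' : CasimirF m f g') :
    g = g' := by
  obtain ⟨p, q, hp, ⟨s, hs, rfl⟩, rfl⟩ := h
  obtain ⟨p', q', hp', ⟨s', hs', rfl⟩, rfl⟩ := h'
  rw [HasSum.unique hp hp', hs.unique hs']

theorem ExpProduct.unique {d : ℕ} {f g g' : SchwartzSpace m} (h : ExpProduct m d f g)
    (h' : ExpProduct m d f g') : g = g' := by
  obtain ⟨f₁, h1, h2⟩ := h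
  obtain ⟨f₁', h1', h2'⟩ := h'
  have hA (u v v' : SchwartzSpace m) (hv : v = (hOp m - ((m : ℂ) / 2) • 1) u)
      (hv' : v' = (hOp m - ((m : ℂ) / 2) • 1) u) : v = v' := hv.trans hv'.symm
  have h3 : f₁ = f₁' := OpExp.unique hA h1 h1'
  rw [← h3] at h2'
  exact OpExp.unique (A := CasimirF m) (fun _ _ _ hu hu' => CasimirF.unique hu hu') h2 h2'

/-- A relation `A` carries no linearity, so the eigenvalue equation is required on all multiples of
f, where the iterates a^n f lie. -/
theorem opExp_of_eigenvector (c : ℂ) {A : SchwartzSpace m → SchwartzSpace m → Prop} {a : ℂ}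
    {f : SchwartzSpace m} (h : ∀ b : ℂ, A (b • f) (a • b • f)) :
    OpExp c A f (Complex.exp (c * a) • f) := by
  refine ⟨fun n => a ^ n • f, by simp, fun n => ?_, ?_⟩
  · simp only [pow_succ', mul_smul]
    exact h _
  · have h1 : HasSum (fun n : ℕ => (c * a) ^ n / (n ! : ℂ)) (Complex.exp (c * a)) := by
      rw [Complex.exp_eq_exp_ℂ]
      exact NormedSpace.expSeries_div_hasSum_exp _
    have h2 := h1.smul_const f
    refine h2.congr_fun fun n => ?_
    rw [smul_smul, mul_pow, div_mul_eq_mul_div]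

/-! The values of `D_n` and `F`. -/

/-- Each factor is (N + l + 1)(N - l), extending the falling product by one factor at each end; once
n > N both sides vanish. -/
theorem prod_sq_sub_sq (N n : ℕ) :
    ∏ l ∈ Finset.range n, (((N : ℂ) + 1 / 2) ^ 2 - ((l : ℂ) + 1 / 2) ^ 2) =
      ((N + n).descFactorial (2 * n) : ℂ) := by
  induction n with
  | zero => simp
  | succ n ih =>
    rw [Finset.prod_range_succ, ih, ← add_assoc, mul_add, mul_one, Nat.succ_descFactorial_succ,
      Nat.descFactorial_succ]
    rcases le_or_gt n N with h | h
    · rw [show N + n - 2 * n = N - n by omega]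
      push_cast [Nat.cast_sub h]
      ring
    · rw [Nat.descFactorial_of_lt (by omega)]
      simp

theorem eval_dPoly (N n : ℕ) :
    (dPoly n).eval (((N : ℂ) + 1 / 2) ^ 2) = ((N + n).choose (2 * n) : ℂ) := by
  rw [dPoly, Polynomial.eval_mul, Polynomial.eval_C, Polynomial.eval_prod]
  simp only [Polynomial.eval_sub, Polynomial.eval_X, Polynomial.eval_C]
  rw [prod_sq_sub_sq, Nat.descFactorial_eq_factorial_mul_choose]
  have : ((2 * n)! : ℂ) ≠ 0 := by exact_mod_cast (Nat.factorial_ne_zero _)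
  push_cast
  field_simp

theorem aeval_apply_of_eigenvector {A : SchwartzOp m} {a : ℂ} {f : SchwartzSpace m}
    (h : A f = a • f) (p : Polynomial ℂ) : Polynomial.aeval A p f = p.eval a • f := by
  induction p using Polynomial.induction_on' with
  | add p q hp hq => rw [map_add, add_apply, hp, hq, Polynomial.eval_add, add_smul]
  | monomial n c =>
    rw [Polynomial.aeval_monomial, Polynomial.eval_monomial, mul_smul, mul_apply_eq_comp,
      Algebra.algebraMap_eq_smul_one, smul_apply, one_apply_eq_self]
    congr 1
    induction n with
    | zero => simp
    | succ n ih => rw [pow_succ, mul_apply_eq_comp, h, map_smul, ih, smul_smul, pow_succ']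

theorem dOp_apply_of_eigenvector {N : ℕ} {f : SchwartzSpace m}
    (h : casimirOp m f = (((N : ℂ) + 1 / 2) ^ 2) • f) (n : ℕ) :
    dOp m n f = ((N + n).choose (2 * n) : ℂ) • f := by
  rw [dOp, aeval_apply_of_eigenvector h, eval_dPoly]

theorem exists_casimirF_of_eigenvector (m N : ℕ) : ∃ z : ℤ, ∀ f : SchwartzSpace m,
    casimirOp m f = (((N : ℂ) + 1 / 2) ^ 2) • f →
    CasimirF m f (((m - 2 : ℂ) * (N ^ 2 + 4 * z) + ((m + 1 : ℂ) / 2) ^ 2) • f) := by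
  -- Truncation at K = N loses nothing: for n ≥ N all indices in the n-th term of either series
  -- exceed N, since 2^n > N.
  obtain ⟨z, hz⟩ := exists_sum_choose_eq_sq (Nat.lt_two_pow_self (n := N))
  refine ⟨z, fun f h => ?_⟩
  have hD := dOp_apply_of_eigenvector h
  set D : ℕ → ℤ := fun n => ((N + n).choose (2 * n) : ℤ) with hDdef
  have hD' (n : ℕ) : dOp m n f = (D n : ℂ) • f := by rw [hD, hDdef]; push_cast; rfl
  have hD0 (n : ℕ) (hn : N < n) : D n = 0 := by
    rw [hDdef]
    simp only
    rw [Nat.choose_eq_zero_of_lt (by omega), Nat.cast_zero]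
  have hlt {n : ℕ} (hn : n ∉ Finset.range N) : N < 2 ^ n := by
    rw [Finset.mem_range, not_lt] at hn
    exact lt_of_le_of_lt hn Nat.lt_two_pow_self
  simp only at hz
  have hp : CalD0011 m f (((∑ n ∈ Finset.range N, (D (2 ^ (n + 1)) +
      ∑ j ∈ Finset.Ico 1 (n + 1), 2 * D (2 ^ (n + 1) + 2 ^ j)) : ℤ) : ℂ) • f) := by
    have e (n : ℕ) : (dOp m (2 ^ (n + 1)) + ∑ j ∈ Finset.Ico 1 (n + 1),
        (2 : ℂ) • dOp m (2 ^ (n + 1) + 2 ^ j)) f = ((D (2 ^ (n + 1)) +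
        ∑ j ∈ Finset.Ico 1 (n + 1), 2 * D (2 ^ (n + 1) + 2 ^ j) : ℤ) : ℂ) • f := by
      rw [add_apply, sum_apply]
      simp only [smul_apply, hD', smul_smul, ← Finset.sum_smul, ← add_smul]
      push_cast
      rfl
    rw [CalD0011]
    simp only [e]
    rw [Int.cast_sum, Finset.sum_smul]
    refine hasSum_sum_of_ne_finset_zero fun n hn => ?_
    have h1 : N < 2 ^ (n + 1) := (hlt hn).trans_le (Nat.pow_le_pow_right (by norm_num) (by omega))
    rw [hD0 _ h1, Finset.sum_eq_zero fun j _ => by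
      rw [hD0 _ (h1.trans_le (Nat.le_add_right _ _)), mul_zero]]
    simp
  have hq : CalD0010 m f (((2 * D 3 + ∑ n ∈ Finset.range N, (D (2 ^ n + 1) +
      ∑ j ∈ Finset.Ico 1 n, 2 * D (2 ^ n + 1 + 2 ^ j)) : ℤ) : ℂ) • f) := by
    have e (n : ℕ) : (dOp m (2 ^ n + 1) + ∑ j ∈ Finset.Ico 1 n,
        (2 : ℂ) • dOp m (2 ^ n + 1 + 2 ^ j)) f = ((D (2 ^ n + 1) +
        ∑ j ∈ Finset.Ico 1 n, 2 * D (2 ^ n + 1 + 2 ^ j) : ℤ) : ℂ) • f := by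
      rw [add_apply, sum_apply]
      simp only [smul_apply, hD', smul_smul, ← Finset.sum_smul, ← add_smul]
      push_cast
      rfl
    refine ⟨((∑ n ∈ Finset.range N, (D (2 ^ n + 1) +
      ∑ j ∈ Finset.Ico 1 n, 2 * D (2 ^ n + 1 + 2 ^ j)) : ℤ) : ℂ) • f, ?_, ?_⟩
    · simp only [e]
      rw [Int.cast_sum, Finset.sum_smul]
      refine hasSum_sum_of_ne_finset_zero fun n hn => ?_
      have h1 := Nat.lt_succ_of_lt (hlt hn)
      rw [hD0 _ h1, Finset.sum_eq_zero fun j _ => by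
        rw [hD0 _ (h1.trans_le (Nat.le_add_right _ _)), mul_zero]]
      simp
    · rw [hD', smul_smul, ← add_smul]
      push_cast
      rfl
  refine ⟨_, _, hp, hq, ?_⟩
  rw [calD0110, add_apply, smul_apply, hD', hD', smul_smul, smul_smul, ← add_smul, ← add_smul,
    ← add_smul, smul_smul, ← add_smul]
  congr 1
  have hz' := congrArg (Int.cast : ℤ → ℂ) hz
  push_cast at hz' ⊢
  rw [← hz']

/-- With m = 2r + 3 one has m - 2 = 2r + 1 and (m + 1)/2 = r + 2, and the congruence is a finite
check over the residues of r and k modulo 4. -/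
theorem exists_F_eq_sq (r k : ℕ) (z : ℤ) : ∃ t : ℤ,
    (((2 * r + 3 : ℕ) - 2 : ℂ) * (((k + r : ℕ) : ℂ) ^ 2 + 4 * z) + (((2 * r + 3 : ℕ) + 1 : ℂ) / 2) ^ 2)
      = (k : ℂ) ^ 2 + 4 * t := by
  have h : ∀ r k : ZMod 4, (2 * r + 1) * (k + r) ^ 2 + (r + 2) ^ 2 - k ^ 2 = 0 := by decide
  have h2 : ((4 : ℕ) : ℤ) ∣ (2 * r + 1) * (k + r) ^ 2 + (r + 2) ^ 2 - k ^ 2 := by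
    rw [← ZMod.intCast_zmod_eq_zero_iff_dvd]
    push_cast
    exact h r k
  obtain ⟨t, ht⟩ := h2
  refine ⟨t + (2 * r + 1) * z, ?_⟩
  have ht' := congrArg (Int.cast : ℤ → ℂ) ht
  push_cast at ht' ⊢
  linear_combination ht'

theorem exp_I_mul_pi_div_two_mul (n : ℕ) :
    Complex.exp (Complex.I * (Real.pi / 2) * n) = Complex.I ^ n := by
  rw [mul_comm _ (n : ℂ), Complex.exp_nat_mul, mul_comm Complex.I, Complex.exp_pi_div_two_mul_I]

/-- The multiple of 4 contributes a full period, and k² is 0 or 1 modulo 4 according to the parity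
of k. -/
theorem exp_I_mul_pi_div_two_mul_sq (d k : ℕ) (t : ℤ) :
    Complex.exp (Complex.I * (Real.pi / 2) * d * ((k : ℂ) ^ 2 + 4 * t)) =
      if Even k then 1 else Complex.I ^ d := by
  have h1 : Complex.I * (Real.pi / 2) * d * ((k : ℂ) ^ 2 + 4 * t) =
      Complex.I * (Real.pi / 2) * ((d * k ^ 2 : ℕ) : ℂ) +
        ((d * t : ℤ) : ℂ) * (2 * Real.pi * Complex.I) := by
    push_cast; ring
  rw [h1, Complex.exp_add, Complex.exp_int_mul_two_pi_mul_I, mul_one, exp_I_mul_pi_div_two_mul]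
  split_ifs with h
  · obtain ⟨a, rfl⟩ := h
    rw [show d * (a + a) ^ 2 = 4 * (d * a ^ 2) by ring, pow_mul, Complex.I_pow_four, one_pow]
  · obtain ⟨a, rfl⟩ := Nat.not_even_iff_odd.1 h
    rw [show d * (2 * a + 1) ^ 2 = 4 * (d * (a ^ 2 + a)) + d by ring, pow_add, pow_mul,
      Complex.I_pow_four, one_pow, one_mul]

theorem isTd_hartleyOp (hm : Odd m) (hm3 : 3 ≤ m) (d : ℕ) : IsTd m d (hartleyOp m d) := by
  obtain ⟨r, rfl⟩ : ∃ r, m = 2 * r + 3 := by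
    obtain ⟨r, rfl⟩ := hm
    exact ⟨r - 1, by omega⟩
  intro v hv
  obtain ⟨j, k, H, hH, rfl⟩ := isHermiteFunction_iff.1 hv
  set f := gaussPoly (2 * r + 3) (hermitePoly j k H) with hf
  -- Oddness of m enters here: k + m/2 - 1 is the half-integer (k + r) + 1/2, at which the D_n are
  -- binomial coefficients.
  have hΩ : casimirOp (2 * r + 3) f = ((((k + r : ℕ) : ℂ) + 1 / 2) ^ 2) • f := by
    rw [casimirOp_gaussPoly_hermitePoly j hH]
    congr 2
    push_cast
    ring
  have hh : (hOp (2 * r + 3) - (((2 * r + 3 : ℕ) : ℂ) / 2) • 1) f = ((k + 2 * j : ℕ) : ℂ) • f := by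
    rw [sub_apply, hOp_gaussPoly_hermitePoly (by omega) j hH, smul_apply, one_apply_eq_self]
    module
  rw [hartleyOp_hermite (by omega) d j hH, ← exp_I_mul_pi_div_two_mul]
  refine ⟨Complex.exp (Complex.I * (Real.pi / 2) * (k + 2 * j : ℕ)) • f,
    opExp_of_eigenvector _ fun b => ?_, ?_⟩
  · rw [map_smul, hh, smul_comm]
  · obtain ⟨z, hz⟩ := exists_casimirF_of_eigenvector (2 * r + 3) (k + r)
    obtain ⟨t, ht⟩ := exists_F_eq_sq r k z
    rw [mul_comm (Complex.exp _), mul_smul, ← exp_I_mul_pi_div_two_mul_sq d k t, ← ht]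
    refine opExp_of_eigenvector _ fun b => ?_
    rw [smul_smul b]
    exact hz _ (by rw [map_smul, hΩ, smul_comm])

end OperatorSeries

theorem theorem2p13 (m : ℕ) (hm : Odd m) (hm3 : 3 ≤ m) (d : ℕ) (hd : d ≤ 3) :
    (∃! T : SchwartzOp m, IsTd m d T) ∧
    ∀ T : SchwartzOp m, IsTd m d T →
      ∀ (f : SchwartzSpace m) (y : EuclideanSpace ℝ (Fin m)),
        MeasureTheory.Integrable
          (fun x : EuclideanSpace ℝ (Fin m) => hartleyKernel d x y * f x) ∧
        T f y = ((1 / (2 * Real.pi) ^ ((m : ℝ) / 2) : ℝ) : ℂ) *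
          ∫ x : EuclideanSpace ℝ (Fin m), hartleyKernel d x y * f x := by
  have huniq : ∀ T : SchwartzOp m, IsTd m d T → T = hartleyOp m d := fun T hT =>
    eq_of_eq_on_isHermiteFunction (by omega) fun v hv =>
      ExpProduct.unique (hT v hv) (isTd_hartleyOp hm hm3 d v hv)
  refine ⟨⟨hartleyOp m d, isTd_hartleyOp hm hm3 d, huniq⟩, fun T hT f y => ?_⟩
  rw [huniq T hT]
  exact ⟨integrable_hartleyKernel_mul d f y, hartleyOp_apply d f y⟩
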